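/- Fix a set $C \subseteq \mathbb{N}$ and a set $A \subseteq \mathbb{N}$ with $A \not\leq_T C$, where $\leq_T$ denotes Turing reducibility. Call a function $f : \mathbb{N} \to \mathbb{N}$ *$C$-computably bounded* if there is a total $C$-computable function $b : \mathbb{N} \to \mathbb{N}$ with $f(x) \leq b(x)$ for all $x$. Then for every $C$-computably bounded function $f : \mathbb{N} \to \mathbb{N}$ (not itself assumed $C$-computable) there is an infinite set $G \subseteq \mathbb{N}$ that is non-decreasing for $f$, i.e. $f(x) \leq f(y)$ for all $x < y$ in $G$, such that $A \not\leq_T G \oplus C$, where $G \oplus C = \{2n : n \in G\} \cup \{2n+1 : n \in C\}$. -/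

import Mathlib

namespace CNS

open Classical in
/-- The characteristic function of a set of natural numbers, as a (total) function
`ℕ →. ℕ` that can serve as an oracle. -/
noncomputable def charFun (S : Set ℕ) : ℕ →. ℕ :=
  fun n => Part.some (if n ∈ S then 1 else 0)

/-- `A ≤_T B` for sets of natural numbers: the characteristic function of `A` is recursive
in the characteristic function of `B`. -/
def SetTuringReducible (A B : Set ℕ) : Prop :=
  TuringReducible (charFun A) (charFun B)

/-- The effective join `G ⊕ C = {2 n : n ∈ G} ∪ {2 n + 1 : n ∈ C}`. -/
def join (G C : Set ℕ) : Set ℕ :=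
  (fun n => 2 * n) '' G ∪ (fun n => 2 * n + 1) '' C

/-- `f` is `C`-computably bounded: it is dominated by a (total) `C`-computable function. -/
def ComputablyBoundedIn (C : Set ℕ) (f : ℕ → ℕ) : Prop :=
  ∃ b : ℕ → ℕ, ComputableIn {charFun C} b ∧ ∀ x, f x ≤ b x

/-- `X` is a non-decreasing subsequence for `f`: `f x ≤ f y` for all `x < y` in `X`. -/
def NonDecreasingFor (f : ℕ → ℕ) (X : Set ℕ) : Prop :=
  ∀ x ∈ X, ∀ y ∈ X, x < y → f x ≤ f y

end CNS

namespace CNS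

open Nat.Partrec (Code)
open Encodable

/-! ### Bounded quantifiers -/

section Quantifiers

variable {α β : Type*} [Primcodable α] [Primcodable β]

/-! The set is built by Mathias-style forcing. A condition is a finite stem on which `f` is
non-decreasing, together with an infinite reservoir `X` such that `a` is not computable from `X ⊕ c`
and `f` is at least as large on `X` as on the stem. The difficulty is that `f` is not available as
an oracle. The remedy is to quantify over all functions `P` below the computable bound: they form a
compact space, so "every `P` admits a finite `P`-non-decreasing extension of the stem inside `X` on
which program `e` outputs `v` at `n`" is semi-decidable in `X ⊕ c`.

If for each `n` this held for `a n` and for no other value, it would compute `a`. So for some `n`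
one of two things happens (`defeats_or_exists_not_red`). Either it holds for a wrong value, and
taking `P = f` gives a legitimate stem extension on which `e` errs. Or it fails for the right value:
the counterexamples `P` form a nonempty effectively closed class, and the cone avoidance basis
theorem (`exists_mem_class_not_red`) gives one with `a` not computable from `P ⊕ X ⊕ c`. Thinning
`X` to an infinite `P`-non-decreasing set (`exists_nondecreasing_of_oracle`) then prevents `e` from
ever giving the value `a n`.

After each stem extension the reservoir must be lifted above the new values of `f`. If some infinite
set with constant `f`-value fails to compute `a` with the help of `c`, it is already a solution.
Otherwise strong cone avoidance for the pigeonhole principle (`exists_homogeneous`) removes the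
values of `f` from the reservoir one at a time (`exists_thin`). The pigeonhole result is proved by
the same forcing question, asked about two stems at once with `P` ranging over 2-colourings. -/

theorem primrecPred_exists_mem {L : α → List β} {p : α → β → Prop} (hL : Primrec L)
    (hp : PrimrecPred fun x : α × β => p x.1 x.2) : PrimrecPred fun a => ∃ b ∈ L a, p a b := by
  have h : PrimrecRel fun (b : β) (a : α) => p a b := hp.comp (Primrec.snd.pair Primrec.fst)
  exact h.exists_mem_list.comp hL Primrec.id

theorem primrecPred_forall_mem {L : α → List β} {p : α → β → Prop} (hL : Primrec L)
    (hp : PrimrecPred fun x : α × β => p x.1 x.2) : PrimrecPred fun a => ∀ b ∈ L a, p a b := by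
  have h : PrimrecRel fun (b : β) (a : α) => p a b := hp.comp (Primrec.snd.pair Primrec.fst)
  exact h.forall_mem_list.comp hL Primrec.id

theorem primrecPred_exists_lt {N : α → ℕ} {p : α → ℕ → Prop} (hN : Primrec N)
    (hp : PrimrecPred fun x : α × ℕ => p x.1 x.2) : PrimrecPred fun a => ∃ b < N a, p a b :=
  (primrecPred_exists_mem (Primrec.list_range.comp hN) hp).of_eq (by simp)

theorem primrecPred_forall_lt {N : α → ℕ} {p : α → ℕ → Prop} (hN : Primrec N)
    (hp : PrimrecPred fun x : α × ℕ => p x.1 x.2) : PrimrecPred fun a => ∀ b < N a, p a b :=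
  (primrecPred_forall_mem (Primrec.list_range.comp hN) hp).of_eq (by simp)

theorem primrecPred_imp {p q : α → Prop} (hp : PrimrecPred p) (hq : PrimrecPred q) :
    PrimrecPred fun a => p a → q a :=
  (hp.not.or hq).of_eq fun a => by tauto

end Quantifiers

/-! ### Initial segments and pairings of oracles -/

/-- The initial segment of length `m` of an oracle. -/
def pre (h : ℕ → ℕ) (m : ℕ) : List ℕ := (List.range m).map h

/-- The pointwise pairing of two oracles. -/
def pr (f g : ℕ → ℕ) : ℕ → ℕ := fun n => Nat.pair (f n) (g n)

@[simp] theorem pre_length (h : ℕ → ℕ) (m : ℕ) : (pre h m).length = m := by simp [pre]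

@[simp] theorem pre_zero (h : ℕ → ℕ) : pre h 0 = [] := rfl

theorem pre_succ (h : ℕ → ℕ) (m : ℕ) : pre h (m + 1) = pre h m ++ [h m] := by
  simp [pre, List.range_succ]

theorem pre_getD (h : ℕ → ℕ) {m x : ℕ} (hx : x < m) (d : ℕ) : (pre h m).getD x d = h x := by
  simp [pre, List.getD, hx]

theorem pre_getElem? (h : ℕ → ℕ) (m x : ℕ) :
    (pre h m)[x]? = if x < m then some (h x) else none := by
  simp only [pre, List.getElem?_map]
  split_ifs with hx <;> simp [hx]

theorem pre_take (h : ℕ → ℕ) {j m : ℕ} (hj : j ≤ m) : (pre h m).take j = pre h j := by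
  simp [pre, ← List.map_take, List.take_range, hj]

theorem pre_prefix (h : ℕ → ℕ) {j m : ℕ} (hj : j ≤ m) : pre h j <+: pre h m := by
  rw [← pre_take h hj]; exact List.take_prefix _ _

theorem pre_congr {f g : ℕ → ℕ} {m : ℕ} : pre f m = pre g m ↔ ∀ x < m, f x = g x := by
  simp [pre]

theorem pre_map (h k : ℕ → ℕ) (m : ℕ) : (pre h m).map k = pre (fun x => k (h x)) m := by
  simp [pre]

theorem zipWith_pre (f g : ℕ → ℕ) (m : ℕ) :
    List.zipWith Nat.pair (pre f m) (pre g m) = pre (pr f g) m := by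
  simp [pre, pr, List.zipWith_map, List.zipWith_self]

theorem primrec_zipWith_pair : Primrec₂ (List.zipWith Nat.pair) := by
  have h : Primrec fun p : List ℕ × List ℕ =>
      (List.range (min p.1.length p.2.length)).map
        fun x => Nat.pair (p.1.getD x 0) (p.2.getD x 0) := by
    refine Primrec.list_map (Primrec.list_range.comp (Primrec.nat_min.comp
      (Primrec.list_length.comp .fst) (Primrec.list_length.comp .snd))) ?_
    exact Primrec₂.natPair.comp
      ((Primrec.list_getD 0).comp (Primrec.fst.comp .fst) .snd)
      ((Primrec.list_getD 0).comp (Primrec.snd.comp .fst) .snd)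
  refine Primrec.of_eq h fun p => ?_
  apply List.ext_getElem
  · simp
  · intro i h1 h2
    simp at h1
    simp [h1]

/-! ### Relative computability of total functions -/

/-- The total function `a` is recursive in the total oracle `h`. -/
def Red (a h : ℕ → ℕ) : Prop :=
  Nat.RecursiveIn {fun n => Part.some (h n)} fun n => Part.some (a n)

theorem Red.trans {a g h : ℕ → ℕ} (h1 : Red a g) (h2 : Red g h) : Red a h :=
  Nat.RecursiveIn.subst h1 fun _ hk => by rw [Set.mem_singleton_iff.1 hk]; exact h2

theorem Red.refl (h : ℕ → ℕ) : Red h h := Nat.RecursiveIn.oracle _ rfl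

theorem Red.comp {f g h : ℕ → ℕ} (hf : Red f h) (hg : Red g h) : Red (fun n => f (g n)) h :=
  (Nat.RecursiveIn.comp hf hg).of_eq fun n => by simp

theorem Red.pr {f g h : ℕ → ℕ} (hf : Red f h) (hg : Red g h) : Red (pr f g) h :=
  (Nat.RecursiveIn.pair hf hg).of_eq fun n => by simp [CNS.pr, Seq.seq]

theorem Red.of_primrec {f h : ℕ → ℕ} (hf : Primrec f) : Red f h :=
  (Primrec.nat_iff.1 hf).recursiveIn

theorem Red.pre (h : ℕ → ℕ) : Red (fun k => encode (pre h k)) h := by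
  have hstep : Red (fun p => encode (((decode (α := List ℕ) p.unpair.2.unpair.2).getD []) ++
      [h p.unpair.2.unpair.1])) h := by
    have h1 : Red (fun p => h p.unpair.2.unpair.1) h :=
      (Red.refl h).comp (.of_primrec (Primrec.fst.comp (Primrec.unpair.comp
        (Primrec.snd.comp Primrec.unpair))))
    have h2 : Primrec fun q : ℕ => encode (((decode (α := List ℕ) q.unpair.1.unpair.2.unpair.2).getD
        []) ++ [q.unpair.2]) := by
      refine Primrec.encode.comp (Primrec.list_append.comp (Primrec.option_getD.comp
        (Primrec.decode.comp ?_) (.const [])) (Primrec.list_cons.comp ?_ (.const [])))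
      · exact Primrec.snd.comp (Primrec.unpair.comp (Primrec.snd.comp (Primrec.unpair.comp
          (Primrec.fst.comp Primrec.unpair))))
      · exact Primrec.snd.comp Primrec.unpair
    have h3 := (Red.of_primrec (h := h) h2).comp ((Red.of_primrec (h := h) Primrec.id).pr h1)
    simpa [CNS.pr] using h3
  have hrec := Nat.RecursiveIn.prec (Red.of_primrec (h := h) (Primrec.const (encode ([] : List ℕ))))
    hstep
  have hcomp := Nat.RecursiveIn.comp hrec
    (Red.of_primrec (h := h) (Primrec₂.natPair.comp (.const 0) Primrec.id))
  refine hcomp.of_eq fun k => ?_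
  simp only [Part.bind_eq_bind, Part.bind_some, Nat.unpair_pair]
  induction k with
  | zero => simp
  | succ k ih =>
    simp only [id] at ih ⊢
    rw [ih]
    simp [pre_succ]

/-- The relation `R` on oracle strings, inputs and outputs computes `a` from the oracle `h`. -/
def Enum (R : List ℕ × ℕ × ℕ → Prop) (h a : ℕ → ℕ) : Prop :=
  ∀ n v, (∃ m, R (pre h m, n, v)) ↔ v = a n

/-- Search through coded pairs `(m, v)` for one accepted by `R`. `Enum` guarantees both that the
search ends and that whichever `v` it finds is correct, so `R` need not be monotone in the oracle
string. -/
theorem Enum.red {R : List ℕ × ℕ × ℕ → Prop} {h a : ℕ → ℕ} (hR : PrimrecPred R)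
    (H : Enum R h a) : Red a h := by
  classical
  have hdec : Primrec fun q : ℕ => if R ((decode (α := List ℕ) q.unpair.2).getD [],
      q.unpair.1.unpair.1, q.unpair.1.unpair.2.unpair.2) then 0 else 1 := by
    refine Primrec.ite (hR.comp ?_) (.const 0) (.const 1)
    refine Primrec.pair (Primrec.option_getD.comp
      (Primrec.decode.comp (Primrec.snd.comp Primrec.unpair)) (.const [])) (Primrec.pair ?_ ?_)
    · exact Primrec.fst.comp (Primrec.unpair.comp (Primrec.fst.comp Primrec.unpair))
    · exact Primrec.snd.comp (Primrec.unpair.comp (Primrec.snd.comp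
        (Primrec.unpair.comp (Primrec.fst.comp Primrec.unpair))))
  have hpre : Red (fun p => encode (pre h p.unpair.2.unpair.1)) h :=
    (Red.pre h).comp (.of_primrec (Primrec.fst.comp (Primrec.unpair.comp
      (Primrec.snd.comp Primrec.unpair))))
  have htest := (Red.of_primrec (h := h) hdec).comp
    ((Red.of_primrec (h := h) Primrec.id).pr hpre)
  have hfind := Nat.RecursiveIn.comp
    (Red.of_primrec (h := h) (Primrec.snd.comp Primrec.unpair)) (Nat.RecursiveIn.rfind htest)
  refine hfind.of_eq_tot fun n => ?_
  obtain ⟨m, hm⟩ := (H n (a n)).2 rfl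
  simp only [Part.map_eq_map, Part.map_some, CNS.pr, id, Nat.unpair_pair, encodek,
    Option.getD_some, Part.bind_eq_bind, Part.mem_bind_iff, Part.mem_some_iff]
  have hspec : ∀ k : ℕ, decide ((if R (pre h k.unpair.1, n, k.unpair.2) then 0 else 1) = 0) = true ↔
      R (pre h k.unpair.1, n, k.unpair.2) := by
    intro k; simp
  obtain ⟨k, hk, -⟩ := Nat.rfind_min' (p := fun k => decide
    ((if R (pre h k.unpair.1, n, k.unpair.2) then 0 else 1) = 0)) (m := Nat.pair m (a n))
    ((hspec _).2 (by simpa using hm))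
  refine ⟨k, hk, ?_⟩
  have := (hspec k).1 (by simpa using Nat.rfind_spec hk)
  exact ((H n _).1 ⟨_, this⟩).symm

theorem Red.of_pre {F : List ℕ → ℕ} (hF : Primrec F) {a h : ℕ → ℕ}
    (H : ∀ n, a n = F (CNS.pre h (n + 1))) : Red a h := by
  have hR : PrimrecPred fun x : List ℕ × ℕ × ℕ => x.1.length = x.2.1 + 1 ∧ x.2.2 = F x.1 :=
    (Primrec.eq.comp (Primrec.list_length.comp .fst)
      (Primrec.succ.comp (Primrec.fst.comp .snd))).and
      (Primrec.eq.comp (Primrec.snd.comp .snd) (hF.comp .fst))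
  refine Enum.red hR fun n v => ?_
  constructor
  · rintro ⟨m, hm, hv⟩
    simp only [pre_length] at hm
    subst hm
    rw [H]; exact hv
  · rintro rfl
    exact ⟨n + 1, by simp, H n⟩

theorem Red.of_map {F : ℕ → ℕ} (hF : Primrec F) {a h : ℕ → ℕ} (H : ∀ n, a n = F (h n)) :
    Red a h := by
  have := (Red.of_primrec (h := h) hF).comp (Red.refl h)
  rwa [← funext H] at this

/-! ### The use principle -/

/-- Induction on the derivation of relative recursiveness. Monotonicity in the string is carried
along because subcomputations with different uses must be merged over one longer prefix. -/
theorem exists_continuous_functional {h : ℕ → ℕ} {f : ℕ →. ℕ}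
    (hf : Nat.RecursiveIn {fun n => Part.some (h n)} f) :
    ∃ φ : List ℕ → ℕ →. ℕ, Partrec₂ φ ∧
      (∀ σ τ n v, σ <+: τ → v ∈ φ σ n → v ∈ φ τ n) ∧
      ∀ n v, v ∈ f n ↔ ∃ k, v ∈ φ (pre h k) n := by
  induction hf with
  | zero =>
    refine ⟨fun _ _ => Part.some 0, (Computable.const 0).partrec, fun _ _ _ _ _ h => h,
      fun n v => ?_⟩
    exact (Part.mem_some_iff (a := 0)).trans (by simp)
  | succ =>
    exact ⟨fun _ n => Part.some n.succ, (Computable.succ.comp .snd).partrec,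
      fun _ _ _ _ _ h => h, fun n v => by simp⟩
  | left =>
    exact ⟨fun _ n => Part.some n.unpair.1, (Computable.fst.comp (Computable.unpair.comp
      .snd)).partrec, fun _ _ _ _ _ h => h, fun n v => by simp⟩
  | right =>
    exact ⟨fun _ n => Part.some n.unpair.2, (Computable.snd.comp (Computable.unpair.comp
      .snd)).partrec, fun _ _ _ _ _ h => h, fun n v => by simp⟩
  | oracle g hg =>
    rw [Set.mem_singleton_iff.1 hg]
    refine ⟨fun σ n => (σ[n]? : Part ℕ), Computable.ofOption
      (Computable.list_getElem?.comp .fst .snd), ?_, fun n v => ?_⟩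
    · rintro σ _ n v ⟨ρ, rfl⟩ hv
      simp only [Part.mem_coe] at hv ⊢
      simp only [Option.mem_def] at hv ⊢
      rw [List.getElem?_append_left]
      · exact hv
      · exact (List.getElem?_eq_some_iff.1 hv).1
    · simp only [Part.mem_coe, pre_getElem?, Part.mem_some_iff]
      constructor
      · rintro rfl
        exact ⟨n + 1, by simp⟩
      · rintro ⟨k, hk⟩
        split_ifs at hk with hlt
        · simpa [eq_comm] using hk
        · simp at hk
  | @pair f g _ _ ihf ihg =>
    obtain ⟨φ, hφ, hφm, hφs⟩ := ihf
    obtain ⟨ψ, hψ, hψm, hψs⟩ := ihg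
    refine ⟨fun σ n => (φ σ n).bind fun x => (ψ σ n).map fun y => Nat.pair x y, ?_, ?_, ?_⟩
    · exact Partrec.bind hφ (Partrec.map
        (hψ.comp (Computable.fst.comp .fst) (Computable.snd.comp .fst))
        (Primrec₂.natPair.to_comp.comp (Computable.snd.comp .fst) .snd).to₂).to₂
    · intro σ τ n v hστ hv
      simp only [Part.mem_bind_iff, Part.mem_map_iff] at hv ⊢
      obtain ⟨x, hx, y, hy, rfl⟩ := hv
      exact ⟨x, hφm _ _ _ _ hστ hx, y, hψm _ _ _ _ hστ hy, rfl⟩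
    · intro n v
      simp only [Seq.seq, Part.map_eq_map, Part.mem_bind_iff, Part.mem_map_iff]
      constructor
      · rintro ⟨_, ⟨x, hx, rfl⟩, y, hy, rfl⟩
        obtain ⟨k, hk⟩ := (hφs _ _).1 hx
        obtain ⟨l, hl⟩ := (hψs _ _).1 hy
        exact ⟨max k l, x, hφm _ _ _ _ (pre_prefix h (le_max_left _ _)) hk, y,
          hψm _ _ _ _ (pre_prefix h (le_max_right _ _)) hl, rfl⟩
      · rintro ⟨k, x, hx, y, hy, rfl⟩
        exact ⟨_, ⟨x, (hφs _ _).2 ⟨k, hx⟩, rfl⟩, y, (hψs _ _).2 ⟨k, hy⟩, rfl⟩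
  | @comp f g _ _ ihf ihg =>
    obtain ⟨φ, hφ, hφm, hφs⟩ := ihf
    obtain ⟨ψ, hψ, hψm, hψs⟩ := ihg
    refine ⟨fun σ n => (ψ σ n).bind fun x => φ σ x, ?_, ?_, ?_⟩
    · exact Partrec.bind hψ (hφ.comp (Computable.fst.comp .fst) .snd).to₂
    · intro σ τ n v hστ hv
      obtain ⟨x, hx, hy⟩ := Part.mem_bind_iff.1 hv
      exact Part.mem_bind_iff.2 ⟨x, hψm _ _ _ _ hστ hx, hφm _ _ _ _ hστ hy⟩
    · intro n v
      constructor
      · intro hv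
        obtain ⟨x, hx, hy⟩ := Part.mem_bind_iff.1 hv
        obtain ⟨k, hk⟩ := (hψs _ _).1 hx
        obtain ⟨l, hl⟩ := (hφs _ _).1 hy
        exact ⟨max k l, Part.mem_bind_iff.2 ⟨x, hψm _ _ _ _ (pre_prefix h (le_max_left _ _)) hk,
          hφm _ _ _ _ (pre_prefix h (le_max_right _ _)) hl⟩⟩
      · rintro ⟨k, hk⟩
        obtain ⟨x, hx, hy⟩ := Part.mem_bind_iff.1 hk
        exact Part.mem_bind_iff.2 ⟨x, (hψs _ _).2 ⟨k, hx⟩, (hφs _ _).2 ⟨k, hy⟩⟩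
  | @prec f g _ _ ihf ihg =>
    obtain ⟨φ, hφ, hφm, hφs⟩ := ihf
    obtain ⟨ψ, hψ, hψm, hψs⟩ := ihg
    let χ : List ℕ → ℕ → ℕ → Part ℕ := fun σ a n =>
      Nat.rec (φ σ a) (fun y IH => IH.bind fun i => ψ σ (Nat.pair a (Nat.pair y i))) n
    have hχm : ∀ σ τ a n v, σ <+: τ → v ∈ χ σ a n → v ∈ χ τ a n := by
      intro σ τ a n v hστ
      induction n generalizing v with
      | zero => exact hφm _ _ _ _ hστ
      | succ n ih =>
        simp only [χ, Part.mem_bind_iff]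
        rintro ⟨x, hx, hy⟩
        exact ⟨x, ih _ hx, hψm _ _ _ _ hστ hy⟩
    refine ⟨fun σ p => χ σ p.unpair.1 p.unpair.2, ?_, fun σ τ n v => hχm σ τ _ _ v, ?_⟩
    · refine Partrec.nat_rec (f := fun p : List ℕ × ℕ => p.2.unpair.2)
        (g := fun p : List ℕ × ℕ => φ p.1 p.2.unpair.1)
        (h := fun (p : List ℕ × ℕ) (q : ℕ × ℕ) =>
          ψ p.1 (Nat.pair p.2.unpair.1 (Nat.pair q.1 q.2))) ?_ ?_ ?_
      · exact Computable.snd.comp (Computable.unpair.comp .snd)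
      · exact hφ.comp .fst (Computable.fst.comp (Computable.unpair.comp .snd))
      · exact (hψ.comp (Computable.fst.comp .fst) (Primrec₂.natPair.to_comp.comp
          (Computable.fst.comp (Computable.unpair.comp (Computable.snd.comp .fst)))
          (Primrec₂.natPair.to_comp.comp (Computable.fst.comp .snd)
            (Computable.snd.comp .snd)))).to₂
    · have key : ∀ a n v, v ∈ (Nat.rec (f a)
          (fun y IH => Part.bind IH fun i => g (Nat.pair a (Nat.pair y i))) n : Part ℕ) ↔
          ∃ k, v ∈ χ (pre h k) a n := by
        intro a n
        induction n with
        | zero => exact hφs _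
        | succ n ih =>
          intro v
          constructor
          · intro hv
            obtain ⟨x, hx, hy⟩ := Part.mem_bind_iff.1 hv
            obtain ⟨k, hk⟩ := (ih _).1 hx
            obtain ⟨l, hl⟩ := (hψs _ _).1 hy
            exact ⟨max k l, Part.mem_bind_iff.2
              ⟨x, hχm _ _ _ _ _ (pre_prefix h (le_max_left _ _)) hk,
                hψm _ _ _ _ (pre_prefix h (le_max_right _ _)) hl⟩⟩
          · rintro ⟨k, hk⟩
            obtain ⟨x, hx, hy⟩ := Part.mem_bind_iff.1 hk
            exact Part.mem_bind_iff.2 ⟨x, (ih _).2 ⟨k, hx⟩, (hψs _ _).2 ⟨k, hy⟩⟩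
      intro p v
      exact key p.unpair.1 p.unpair.2 v
  | @rfind f _ ihf =>
    obtain ⟨φ, hφ, hφm, hφs⟩ := ihf
    have hmem : ∀ (θ : ℕ →. ℕ) n v,
        v ∈ (Nat.rfind fun m => (θ (Nat.pair n m)).map fun x => decide (x = 0)) ↔
          0 ∈ θ (Nat.pair n v) ∧ ∀ m < v, ∃ y, y ∈ θ (Nat.pair n m) ∧ y ≠ 0 := by
      intro θ n v
      refine Nat.mem_rfind.trans (and_congr ?_ (forall_congr' fun m => ?_))
      · refine (Part.mem_map_iff _).trans ?_
        simp
      · refine imp_congr_right fun _ => (Part.mem_map_iff _).trans ?_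
        simp
    refine ⟨fun σ a => Nat.rfind fun n => (φ σ (Nat.pair a n)).map fun m => decide (m = 0),
      ?_, ?_, ?_⟩
    · refine Partrec.rfind (p := fun (q : List ℕ × ℕ) (n : ℕ) =>
        (φ q.1 (Nat.pair q.2 n)).map fun m => decide (m = 0)) ?_
      have h1 : Partrec fun q : (List ℕ × ℕ) × ℕ => φ q.1.1 (Nat.pair q.1.2 q.2) :=
        hφ.comp (Computable.fst.comp .fst) (Primrec₂.natPair.to_comp.comp
          (Computable.snd.comp .fst) .snd)
      have h2 : Computable₂ fun (_ : (List ℕ × ℕ) × ℕ) (m : ℕ) => decide (m = 0) :=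
        (Primrec.eq.decide.comp .snd (.const 0)).to_comp
      exact (h1.map h2).to₂
    · intro σ τ n v hστ hv
      obtain ⟨h0, hlt⟩ := (hmem _ _ _).1 hv
      refine (hmem _ _ _).2 ⟨hφm _ _ _ _ hστ h0, fun m hm => ?_⟩
      obtain ⟨y, hy, hy0⟩ := hlt m hm
      exact ⟨y, hφm _ _ _ _ hστ hy, hy0⟩
    · intro n v
      refine (hmem f n v).trans ?_
      constructor
      · rintro ⟨hx, hlt⟩
        obtain ⟨k, hk⟩ := (hφs _ _).1 hx
        have h1 : ∀ m, ∃ l, m < v → ∃ y, y ∈ φ (pre h l) (Nat.pair n m) ∧ y ≠ 0 := by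
          intro m
          by_cases hm : m < v
          · obtain ⟨y, hy, hy0⟩ := hlt m hm
            obtain ⟨l, hl⟩ := (hφs _ _).1 hy
            exact ⟨l, fun _ => ⟨y, hl, hy0⟩⟩
          · exact ⟨0, fun h => absurd h hm⟩
        -- The search evaluates finitely many earlier arguments, each with its own use; a common
        -- prefix covers them all.
        choose l hl using h1
        refine ⟨max k ((Finset.range v).sup l), (hmem _ _ _).2
          ⟨hφm _ _ _ _ (pre_prefix h (le_max_left _ _)) hk, fun m hm => ?_⟩⟩
        obtain ⟨y, hy, hy0⟩ := hl m hm
        exact ⟨y, hφm _ _ _ _ (pre_prefix h ((Finset.le_sup (f := l)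
          (Finset.mem_range.2 hm)).trans (le_max_right _ _))) hy, hy0⟩
      · rintro ⟨k, hk⟩
        obtain ⟨h0, hlt⟩ := (hmem _ _ _).1 hk
        refine ⟨(hφs _ _).2 ⟨k, h0⟩, fun m hm => ?_⟩
        obtain ⟨y, hy, hy0⟩ := hlt m hm
        exact ⟨y, (hφs _ _).2 ⟨k, hy⟩, hy0⟩

/-- The oracle computations of the program `e`, as a relation on oracle strings, inputs and
outputs. -/
def Phi (e : Code) : List ℕ × ℕ × ℕ → Prop := fun x =>
  ∃ j < x.1.length + 1, x.2.2 ∈ e.evaln x.1.length (encode (x.1.take j, x.2.1))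

theorem primrecPred_Phi (e : Code) : PrimrecPred (Phi e) := by
  refine primrecPred_exists_lt (Primrec.succ.comp (Primrec.list_length.comp .fst)) ?_
  refine Primrec.eq.comp (Code.primrec_evaln.comp (Primrec.pair (Primrec.pair
    (Primrec.list_length.comp (Primrec.fst.comp .fst)) (.const e)) (Primrec.encode.comp
      (Primrec.pair (Primrec.list_take.comp .snd (Primrec.fst.comp .fst))
        (Primrec.fst.comp (Primrec.snd.comp .fst))))))
    (Primrec.option_some.comp (Primrec.snd.comp (Primrec.snd.comp .fst)))

/-- The functional is only partial recursive, so `Phi` runs it with a step bound. The string length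
serves as that bound while every initial segment is tried as oracle; use `k` and running time `s`
are thus both met at length `max k s`. -/
theorem Red.exists_enum {a h : ℕ → ℕ} (H : Red a h) : ∃ e, Enum (Phi e) h a := by
  obtain ⟨φ, hφ, hφm, hφs⟩ := exists_continuous_functional H
  obtain ⟨e, he⟩ := Code.exists_code.1 hφ
  have hev : ∀ σ n, e.eval (encode (σ, n)) = φ σ n := by
    intro σ n
    rw [he]
    simp [Part.map_id']
  refine ⟨e, fun n v => ⟨?_, ?_⟩⟩
  · rintro ⟨m, j, hj, hv⟩
    have hv := Code.evaln_sound hv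
    rw [hev] at hv
    simp only [pre_length] at hj
    rw [pre_take _ (by omega)] at hv
    simpa using (hφs n v).2 ⟨j, hv⟩
  · rintro rfl
    obtain ⟨k, hk⟩ := (hφs n (a n)).1 (by simp)
    rw [← hev, Code.evaln_complete] at hk
    obtain ⟨s, hs⟩ := hk
    refine ⟨max k s, k, by simp, ?_⟩
    simp only [pre_length]
    rw [pre_take _ (le_max_left _ _)]
    exact Code.evaln_mono (le_max_right _ _) hs

/-! ### Compactness of bounded spaces of functions -/

/-- The strings bounded entrywise by `bs`. -/
def boundedStrings (bs : List ℕ) : List (List ℕ) :=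
  bs.foldr (fun b acc => (List.range (b + 1)).flatMap fun x => acc.map fun ρ => x :: ρ) [[]]

theorem mem_boundedStrings {bs ρ : List ℕ} :
    ρ ∈ boundedStrings bs ↔ List.Forall₂ (· ≤ ·) ρ bs := by
  induction bs generalizing ρ with
  | nil => simp [boundedStrings]
  | cons b bs ih =>
    have : boundedStrings (b :: bs) =
        (List.range (b + 1)).flatMap fun x => (boundedStrings bs).map fun ρ => x :: ρ := rfl
    rw [this, List.forall₂_cons_right_iff]
    simp only [List.mem_flatMap, List.mem_range, List.mem_map, ih]
    constructor
    · rintro ⟨x, hx, τ, hτ, rfl⟩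
      exact ⟨x, τ, by omega, hτ, rfl⟩
    · rintro ⟨x, τ, hx, hτ, rfl⟩
      exact ⟨x, by omega, τ, hτ, rfl⟩

theorem primrec_boundedStrings : Primrec boundedStrings := by
  have h : Primrec₂ fun (_ : List ℕ) (p : ℕ × List (List ℕ)) =>
      (List.range (p.1 + 1)).flatMap fun x => p.2.map fun ρ => x :: ρ := by
    have h1 : Primrec₂ fun (q : List ℕ × ℕ × List (List ℕ)) (x : ℕ) =>
        q.2.2.map fun ρ => x :: ρ :=
      Primrec.list_map (Primrec.snd.comp (Primrec.snd.comp .fst))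
        (Primrec.list_cons.comp (Primrec.snd.comp .fst) .snd).to₂
    have h2 : Primrec fun q : List ℕ × ℕ × List (List ℕ) => List.range (q.2.1 + 1) :=
      Primrec.list_range.comp (Primrec.succ.comp (Primrec.fst.comp .snd))
    exact Primrec.list_flatMap h2 h1
  exact Primrec.list_foldr Primrec.id (.const [[]]) h

theorem mem_boundedStrings_pre {β : ℕ → ℕ} {m : ℕ} {ρ : List ℕ} :
    ρ ∈ boundedStrings (pre β m) ↔ ∃ P : ℕ → ℕ, (∀ x, P x ≤ β x) ∧ pre P m = ρ := by
  rw [mem_boundedStrings, List.forall₂_iff_get]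
  constructor
  · rintro ⟨hlen, hle⟩
    rw [pre_length] at hlen
    refine ⟨fun x => ρ.getD x 0, fun x => ?_, ?_⟩
    · by_cases hx : x < m
      · have := hle x (by omega) (by simpa using hx)
        simpa [pre, List.getD, hlen, hx] using this
      · simp [List.getD, hlen, hx]
    · apply List.ext_getElem
      · simp [hlen]
      · intro i h1 h2
        simp [pre, List.getD, h2]
  · rintro ⟨P, hP, rfl⟩
    refine ⟨by simp, fun i h1 h2 => ?_⟩
    simpa [pre] using hP i

theorem isCompact_bounded (β : ℕ → ℕ) : IsCompact {P : ℕ → ℕ | ∀ x, P x ≤ β x} := by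
  have : {P : ℕ → ℕ | ∀ x, P x ≤ β x} = Set.pi Set.univ fun x => Set.Iic (β x) := by
    ext; simp [Pi.le_def]
  rw [this]
  exact isCompact_univ_pi fun x => (Set.finite_Iic _).isCompact

theorem isOpen_setOf_pre (h : ℕ → ℕ) (m : ℕ) (Q : List ℕ → Prop) :
    IsOpen {P : ℕ → ℕ | Q (pre (pr P h) m)} := by
  have hc : Continuous fun (P : ℕ → ℕ) (x : Fin m) => P x := by fun_prop
  convert! (isOpen_discrete
    {p : Fin m → ℕ | Q (List.ofFn fun x => Nat.pair (p x) (h x))}).preimage hc using 1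
  ext P
  have : pre (pr P h) m = List.ofFn fun x : Fin m => Nat.pair (P x) (h x) := by
    apply List.ext_getElem <;> simp [pre, pr]
  simp [this]

/-- Compactness of the bounded functions, since each condition depends on finitely many coordinates.
`Q` is not assumed monotone; allowing all `j ≤ m` makes the open cover directed. -/
theorem exists_uniform_of_forall_exists {β h : ℕ → ℕ} {Q : List ℕ → Prop}
    (H : ∀ P : ℕ → ℕ, (∀ x, P x ≤ β x) → ∃ m, Q (pre (pr P h) m)) :
    ∃ m, ∀ P : ℕ → ℕ, (∀ x, P x ≤ β x) → ∃ j ≤ m, Q (pre (pr P h) j) := by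
  have hopen : ∀ m, IsOpen {P : ℕ → ℕ | ∃ j ≤ m, Q (pre (pr P h) j)} := fun m => by
    have : {P : ℕ → ℕ | ∃ j ≤ m, Q (pre (pr P h) j)} =
        ⋃ j, ⋃ _ : j ≤ m, {P : ℕ → ℕ | Q (pre (pr P h) j)} := by ext; simp
    rw [this]
    exact isOpen_iUnion fun j => isOpen_iUnion fun _ => isOpen_setOf_pre h j Q
  obtain ⟨m, hm⟩ := (isCompact_bounded β).elim_directed_cover _ hopen
    (fun P hP => by
      obtain ⟨m, hm⟩ := H P hP
      exact Set.mem_iUnion.2 ⟨m, m, le_rfl, hm⟩)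
    (directed_of_isDirected_le fun m k hmk P ⟨j, hj, hQ⟩ => ⟨j, hj.trans hmk, hQ⟩)
  exact ⟨m, fun P hP => hm hP⟩

/-! ### Cone avoidance for effectively closed classes -/

/-- If `a` is not recursive in `h`, an effectively open condition on bounded functions either
holds everywhere with an incorrect value, or fails somewhere with the correct value. -/
theorem exists_forall_wrong_or_exists_not {a h β : ℕ → ℕ} (ha : ¬ Red a h) (hβ : Primrec β)
    {R : List ℕ × ℕ × ℕ → Prop} (hR : PrimrecPred R) :
    ∃ n, (∃ v ≠ a n, ∀ P : ℕ → ℕ, (∀ x, P x ≤ β (h x)) → ∃ m, R (pre (pr P h) m, n, v)) ∨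
      ∃ P : ℕ → ℕ, (∀ x, P x ≤ β (h x)) ∧ ∀ m, ¬ R (pre (pr P h) m, n, a n) := by
  -- If both alternatives fail at every `n`, then `a n` is the only `v` for which every bounded `P`
  -- meets `R`. By compactness this is witnessed by a prefix of `h`, from which the bounds are also
  -- read, so `a` would be recursive in `h`.
  by_contra! hcon
  apply ha
  have hR' : PrimrecPred fun x : List ℕ × ℕ × ℕ => ∀ ρ ∈ boundedStrings (x.1.map β),
      ∃ j < x.1.length + 1, R ((List.zipWith Nat.pair ρ x.1).take j, x.2.1, x.2.2) := by
    refine primrecPred_forall_mem (primrec_boundedStrings.comp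
      (Primrec.list_map .fst (hβ.comp .snd).to₂)) ?_
    refine primrecPred_exists_lt (Primrec.succ.comp (Primrec.list_length.comp
      (Primrec.fst.comp .fst))) (hR.comp (Primrec.pair (Primrec.list_take.comp .snd ?_) ?_))
    · exact primrec_zipWith_pair.comp (Primrec.snd.comp .fst)
        (Primrec.fst.comp (Primrec.fst.comp .fst))
    · exact Primrec.snd.comp (Primrec.fst.comp .fst)
  have hiff : ∀ n v, (∃ m, ∀ ρ ∈ boundedStrings ((pre h m).map β), ∃ j < (pre h m).length + 1,
      R ((List.zipWith Nat.pair ρ (pre h m)).take j, n, v)) ↔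
      ∀ P : ℕ → ℕ, (∀ x, P x ≤ β (h x)) → ∃ m, R (pre (pr P h) m, n, v) := by
    intro n v
    constructor
    · rintro ⟨m, hm⟩ P hP
      obtain ⟨j, hj, hr⟩ := hm (pre P m) (by
        rw [pre_map]; exact mem_boundedStrings_pre.2 ⟨P, hP, rfl⟩)
      rw [pre_length] at hj
      rw [zipWith_pre, pre_take _ (by omega)] at hr
      exact ⟨j, hr⟩
    · intro H
      obtain ⟨m, hm⟩ := exists_uniform_of_forall_exists (Q := fun σ => R (σ, n, v)) H
      refine ⟨m, fun ρ hρ => ?_⟩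
      rw [pre_map] at hρ
      obtain ⟨P, hP, rfl⟩ := mem_boundedStrings_pre.1 hρ
      obtain ⟨j, hj, hr⟩ := hm P hP
      refine ⟨j, by simpa using Nat.lt_succ_of_le hj, ?_⟩
      rwa [zipWith_pre, pre_take _ hj]
  refine Enum.red hR' fun n v => ?_
  refine (hiff n v).trans ⟨fun H => ?_, ?_⟩
  · by_contra hv
    obtain ⟨P, hP, hn⟩ := (hcon n).1 v hv
    obtain ⟨m, hm⟩ := H P hP
    exact hn m hm
  · rintro rfl P hP
    exact (hcon n).2 P hP

/-- Apply the dichotomy to "`P` leaves the class, or `e` gives value `v`". Either `e` already errs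
on every member of the class, or some member never yields the correct value at `n`, and the class is
shrunk to all such members. -/
theorem exists_subclass_not_enum {a h β : ℕ → ℕ} (ha : ¬ Red a h) (hβ : Primrec β)
    {B : List ℕ → Prop} (hB : PrimrecPred B)
    (hne : ∃ P : ℕ → ℕ, (∀ x, P x ≤ β (h x)) ∧ ∀ m, ¬ B (pre (pr P h) m)) (e : Code) :
    ∃ B' : List ℕ → Prop, PrimrecPred B' ∧ (∀ σ, B σ → B' σ) ∧
      (∃ P : ℕ → ℕ, (∀ x, P x ≤ β (h x)) ∧ ∀ m, ¬ B' (pre (pr P h) m)) ∧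
      ∀ P : ℕ → ℕ, (∀ x, P x ≤ β (h x)) → (∀ m, ¬ B' (pre (pr P h) m)) →
        ¬ Enum (Phi e) (pr P h) a := by
  have hR : PrimrecPred fun x : List ℕ × ℕ × ℕ => B x.1 ∨ Phi e x :=
    (hB.comp .fst).or (primrecPred_Phi e)
  obtain ⟨n, ⟨v, hv, H⟩ | ⟨P, hP, H⟩⟩ := exists_forall_wrong_or_exists_not ha hβ hR
  · refine ⟨B, hB, fun _ h => h, hne, fun P hP hPB hen => ?_⟩
    obtain ⟨m, hm⟩ := H P hP
    exact hv ((hen n v).1 ⟨m, hm.resolve_left (hPB m)⟩)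
  · refine ⟨fun σ => B σ ∨ Phi e (σ, n, a n), hR.comp (f := fun σ : List ℕ => (σ, n, a n))
      (Primrec.id.pair (.const (n, a n))), fun _ => Or.inl, ⟨P, hP, H⟩, fun P hP hPB hen => ?_⟩
    obtain ⟨m, hm⟩ := (hen n (a n)).2 rfl
    exact hPB m (Or.inr hm)

/-- The cone avoidance basis theorem for effectively closed classes of bounded functions. -/
theorem exists_mem_class_not_red {a h β : ℕ → ℕ} (ha : ¬ Red a h) (hβ : Primrec β)
    {B : List ℕ → Prop} (hB : PrimrecPred B)
    (hne : ∃ P : ℕ → ℕ, (∀ x, P x ≤ β (h x)) ∧ ∀ m, ¬ B (pre (pr P h) m)) :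
    ∃ P : ℕ → ℕ, (∀ x, P x ≤ β (h x)) ∧ (∀ m, ¬ B (pre (pr P h) m)) ∧ ¬ Red a (pr P h) := by
  let T := {B : List ℕ → Prop // PrimrecPred B ∧
    ∃ P : ℕ → ℕ, (∀ x, P x ≤ β (h x)) ∧ ∀ m, ¬ B (pre (pr P h) m)}
  have hstep : ∀ (t : T) (e : Code), ∃ t' : T, (∀ σ, t.1 σ → t'.1 σ) ∧
      ∀ P : ℕ → ℕ, (∀ x, P x ≤ β (h x)) → (∀ m, ¬ t'.1 (pre (pr P h) m)) →
        ¬ Enum (Phi e) (pr P h) a := by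
    rintro ⟨B, hB, hne⟩ e
    obtain ⟨B', h1, h2, h3, h4⟩ := exists_subclass_not_enum ha hβ hB hne e
    exact ⟨⟨B', h1, h3⟩, h2, h4⟩
  choose next hsub hnot using hstep
  let s : ℕ → T := fun k => Nat.rec ⟨B, hB, hne⟩ (fun k t => next t (Denumerable.ofNat Code k)) k
  let D : ℕ → Set (ℕ → ℕ) := fun k =>
    {P | ∀ x, P x ≤ β (h x)} ∩ ⋂ m, {P | (s k).1 (pre (pr P h) m)}ᶜ
  have hclosed : ∀ k, IsClosed (⋂ m, {P : ℕ → ℕ | (s k).1 (pre (pr P h) m)}ᶜ) := fun k =>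
    isClosed_iInter fun m => (isOpen_setOf_pre h m (s k).1).isClosed_compl
  have hK := isCompact_bounded fun x => β (h x)
  -- The classes are nested, nonempty and compact, and the class at stage `k + 1` defeats the
  -- program numbered `k`; any common member defeats them all.
  obtain ⟨P, hP⟩ := IsCompact.nonempty_iInter_of_sequence_nonempty_isCompact_isClosed D
    (fun k P hP => ⟨hP.1, Set.mem_iInter.2 fun m hm =>
      Set.mem_iInter.1 hP.2 m (hsub (s k) _ _ hm)⟩)
    (fun k => by
      obtain ⟨P, hP, hm⟩ := (s k).2.2
      exact ⟨P, hP, Set.mem_iInter.2 hm⟩)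
    (hK.inter_right (hclosed 0)) (fun k => hK.isClosed.inter (hclosed k))
  rw [Set.mem_iInter] at hP
  refine ⟨P, (hP 0).1, fun m => Set.mem_iInter.1 (hP 0).2 m, fun hred => ?_⟩
  obtain ⟨e, he⟩ := hred.exists_enum
  have := hnot (s (encode e)) (Denumerable.ofNat Code (encode e)) P (hP 0).1
    fun m => Set.mem_iInter.1 (hP (encode e + 1)).2 m
  rw [Denumerable.ofNat_encode] at this
  exact this he

/-- If `a` is not recursive in `h`, an effectively open condition on bounded functions either
holds everywhere with an incorrect value, or fails with the correct value at a bounded function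
that does not help to compute `a`. -/
theorem exists_forall_wrong_or_exists_not_red {a h β : ℕ → ℕ} (ha : ¬ Red a h) (hβ : Primrec β)
    {R : List ℕ × ℕ × ℕ → Prop} (hR : PrimrecPred R) :
    ∃ n, (∃ v ≠ a n, ∀ P : ℕ → ℕ, (∀ x, P x ≤ β (h x)) → ∃ m, R (pre (pr P h) m, n, v)) ∨
      ∃ P : ℕ → ℕ, (∀ x, P x ≤ β (h x)) ∧ (∀ m, ¬ R (pre (pr P h) m, n, a n)) ∧
        ¬ Red a (pr P h) := by
  obtain ⟨n, H | H⟩ := exists_forall_wrong_or_exists_not ha hβ hR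
  · exact ⟨n, Or.inl H⟩
  · exact ⟨n, Or.inr (exists_mem_class_not_red ha hβ
      (hR.comp (f := fun σ : List ℕ => (σ, n, a n)) (Primrec.id.pair (.const (n, a n)))) H)⟩

/-! ### Extending a finite stem inside a reservoir -/

/-- The set with characteristic function `G` has stem `D` below `l`, and its other elements lie in
the reservoir `X`. -/
structure Ext (D : ℕ → ℕ) (l : ℕ) (X G : ℕ → ℕ) : Prop where
  le_one : ∀ x, G x ≤ 1
  agree : ∀ x < l, G x = D x
  mem : ∀ x, l ≤ x → G x ≠ 0 → X x ≠ 0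

theorem Ext.mono {D X X' G : ℕ → ℕ} {l : ℕ} (h : Ext D l X G) (hX : ∀ x, X x ≠ 0 → X' x ≠ 0) :
    Ext D l X' G :=
  ⟨h.le_one, h.agree, fun x hx hG => hX x (h.mem x hx hG)⟩

theorem Ext.trans {D D' X X' G : ℕ → ℕ} {l l' : ℕ} (h : Ext D l X D') (h' : Ext D' l' X' G)
    (hl : l ≤ l') (hX : ∀ x, X' x ≠ 0 → X x ≠ 0) : Ext D l X G := by
  refine ⟨h'.le_one, fun x hx => ?_, fun x hx hG => ?_⟩
  · rw [h'.agree x (by omega), h.agree x hx]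
  · by_cases hxl : x < l'
    · exact h.mem x hx (by rwa [← h'.agree x hxl])
    · exact hX x (h'.mem x (by omega) hG)

theorem Ext.self {D X : ℕ → ℕ} {l : ℕ} (h1 : ∀ x, D x ≤ 1) (h0 : ∀ x, l ≤ x → D x = 0) :
    Ext D l X D :=
  ⟨h1, fun _ _ => rfl, fun x hx hD => absurd (h0 x hx) hD⟩

/-- Strict growth gives `x < l (x + 1)`, so the value at `x` is settled by stage `x + 1` and the
limit can be read off the diagonal. -/
theorem Ext.exists_limit {D X : ℕ → ℕ → ℕ} {l : ℕ → ℕ} (hl : StrictMono l)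
    (hD : ∀ s, Ext (D s) (l s) (X s) (D (s + 1))) (hX : ∀ s x, X (s + 1) x ≠ 0 → X s x ≠ 0) :
    ∃ G, ∀ s, Ext (D s) (l s) (X s) G := by
  have hXm : ∀ s k x, X (s + k) x ≠ 0 → X s x ≠ 0 := by
    intro s k x
    induction k with
    | zero => exact id
    | succ k ih => exact fun h => ih (hX _ _ h)
  have hE : ∀ s k, Ext (D s) (l s) (X s) (D (s + k + 1)) := by
    intro s k
    induction k with
    | zero => exact hD s
    | succ k ih => exact ih.trans (hD (s + k + 1)) (hl.monotone (by omega)) (hXm s (k + 1))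
  have hst : ∀ s x, D (max s x + 2) x = D (x + 1) x := by
    intro s x
    have := (hE (x + 1) (max s x - x)).agree x (lt_of_lt_of_le (Nat.lt_succ_self x) hl.le_apply)
    rwa [show x + 1 + (max s x - x) + 1 = max s x + 2 by omega] at this
  refine ⟨fun x => D (x + 1) x, fun s => ⟨fun x => (hD x).le_one x, fun x hx => ?_,
    fun x hx hG => ?_⟩⟩
  · have := (hE s (max s x + 1 - s)).agree x hx
    rw [show s + (max s x + 1 - s) + 1 = max s x + 2 by omega, hst] at this
    exact this
  · have := (hE s (max s x + 1 - s)).mem x hx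
    rw [show s + (max s x + 1 - s) + 1 = max s x + 2 by omega, hst] at this
    exact this hG

/-- The set with characteristic function `G` has stem `D` below `l`, its other elements lie in the
reservoir `X`, and the values of `P` at these elements are pairwise related by `T`. -/
structure Compat (T : ℕ → ℕ → Prop) (D : ℕ → ℕ) (l : ℕ) (X P G : ℕ → ℕ) : Prop extends
    Ext D l X G where
  rel : ∀ x, ∀ y ≤ x, l ≤ y → G y ≠ 0 → G x ≠ 0 → T (P y) (P x)

/-- The computation `e` gives a value at a string compatible with the stem, with the reservoir and
with the function which are recorded in the oracle. -/
def StemPhi (T : ℕ → ℕ → Prop) (D : ℕ → ℕ) (l : ℕ) (e : Code) (x : List ℕ × ℕ × ℕ) : Prop :=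
  ∃ τ ∈ boundedStrings (x.1.map fun _ => 1),
    (∀ i < x.1.length, (i < l → τ.getD i 0 = (pre D l).getD i 0) ∧
      ∀ j < i + 1, l ≤ j → τ.getD j 0 ≠ 0 → τ.getD i 0 ≠ 0 →
        (x.1.getD i 0).unpair.2.unpair.1 ≠ 0 ∧
          T (x.1.getD j 0).unpair.1 (x.1.getD i 0).unpair.1) ∧
    Phi e (List.zipWith Nat.pair τ (x.1.map fun z => z.unpair.2.unpair.2), x.2)

theorem primrecPred_StemPhi {T : ℕ → ℕ → Prop} (hT : PrimrecRel T) (D : ℕ → ℕ) (l : ℕ) (e : Code) :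
    PrimrecPred (StemPhi T D l e) := by
  have hu1 : Primrec fun z : ℕ => z.unpair.1 := Primrec.fst.comp Primrec.unpair
  have hu2 : Primrec fun z : ℕ => z.unpair.2 := Primrec.snd.comp Primrec.unpair
  have hget : ∀ {α : Type} [Primcodable α] {f : α → List ℕ} {g : α → ℕ}, Primrec f → Primrec g →
      Primrec fun a => (f a).getD (g a) 0 := fun hf hg => (Primrec.list_getD 0).comp hf hg
  refine primrecPred_exists_mem (primrec_boundedStrings.comp
    (Primrec.list_map .fst (Primrec.const 1).to₂)) (PrimrecPred.and ?_ ?_)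
  · refine primrecPred_forall_lt (Primrec.list_length.comp (Primrec.fst.comp .fst))
      (PrimrecPred.and ?_ ?_)
    · refine primrecPred_imp (Primrec.nat_lt.comp .snd (.const l)) (Primrec.eq.comp ?_ ?_)
      · exact hget (Primrec.snd.comp .fst) .snd
      · exact hget (.const _) .snd
    · refine primrecPred_forall_lt (Primrec.succ.comp .snd) ?_
      refine primrecPred_imp (Primrec.nat_le.comp (.const l) .snd) ?_
      have hσ : Primrec fun q : (((List ℕ × ℕ × ℕ) × List ℕ) × ℕ) × ℕ => q.1.1.1.1 :=
        Primrec.fst.comp (Primrec.fst.comp (Primrec.fst.comp .fst))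
      have hτ : Primrec fun q : (((List ℕ × ℕ × ℕ) × List ℕ) × ℕ) × ℕ => q.1.1.2 :=
        Primrec.snd.comp (Primrec.fst.comp .fst)
      have hi : Primrec fun q : (((List ℕ × ℕ × ℕ) × List ℕ) × ℕ) × ℕ => q.1.2 :=
        Primrec.snd.comp .fst
      refine primrecPred_imp (Primrec.eq.comp (hget hτ .snd) (.const 0)).not ?_
      refine primrecPred_imp (Primrec.eq.comp (hget hτ hi) (.const 0)).not ?_
      refine PrimrecPred.and (Primrec.eq.comp (hu1.comp (hu2.comp (hget hσ hi))) (.const 0)).not ?_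
      exact hT.comp (hu1.comp (hget hσ .snd)) (hu1.comp (hget hσ hi))
  · refine (primrecPred_Phi e).comp (Primrec.pair (primrec_zipWith_pair.comp .snd
      (Primrec.list_map (Primrec.fst.comp .fst) ?_)) (Primrec.snd.comp .fst))
    exact (hu2.comp (hu2.comp .snd)).to₂

/-- A computation sees only a finite part of `G`, so a `P` that refutes `StemPhi` at one value
blocks that value for all compatible `G` simultaneously. -/
theorem Compat.stemPhi {T : ℕ → ℕ → Prop} {D X P G c : ℕ → ℕ} {l : ℕ} (h : Compat T D l X P G)
    {e : Code} {m n v : ℕ} (hv : Phi e (pre (pr G c) m, n, v)) :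
    StemPhi T D l e (pre (pr P (pr X c)) m, n, v) := by
  refine ⟨pre G m, ?_, ?_, ?_⟩
  · rw [pre_map]
    exact mem_boundedStrings_pre.2 ⟨G, h.le_one, rfl⟩
  · intro i hi
    rw [pre_length] at hi
    refine ⟨fun hil => ?_, fun j hj hlj hGj hGi => ?_⟩
    · rw [pre_getD _ hi, pre_getD _ hil, h.agree i hil]
    · rw [pre_getD _ (by omega)] at hGj
      rw [pre_getD _ hi] at hGi
      rw [pre_getD _ hi, pre_getD _ (by omega)]
      simp only [pr, Nat.unpair_pair]
      exact ⟨h.mem i (by omega) hGi, h.rel i j (by omega) hlj hGj hGi⟩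
  · simpa [pre_map, zipWith_pre, pr] using hv

theorem StemPhi.exists_compat {T : ℕ → ℕ → Prop} {D X P c : ℕ → ℕ} {l : ℕ} {e : Code} {m n v : ℕ}
    (hD1 : ∀ x, D x ≤ 1) (hD0 : ∀ x, l ≤ x → D x = 0)
    (h : StemPhi T D l e (pre (pr P (pr X c)) m, n, v)) :
    ∃ G, Compat T D l X P G ∧ (∀ x, max m l ≤ x → G x = 0) ∧ Phi e (pre (pr G c) m, n, v) := by
  obtain ⟨τ, hτ, hcompat, hPhi⟩ := h
  rw [pre_map] at hτ
  obtain ⟨G, hG, rfl⟩ := mem_boundedStrings_pre.1 hτ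
  simp only [pre_length] at hcompat
  have hge : ∀ x, l ≤ x → (if x < m then G x else D x) ≠ 0 → x < m ∧ G x ≠ 0 := by
    intro x hx h0
    split_ifs at h0 with hxm
    · exact ⟨hxm, h0⟩
    · exact absurd (hD0 x hx) h0
  have key : ∀ x, ∀ y ≤ x, l ≤ y → (if y < m then G y else D y) ≠ 0 →
      (if x < m then G x else D x) ≠ 0 → X x ≠ 0 ∧ T (P y) (P x) := by
    intro x y hyx hly hy hx
    obtain ⟨hxm, hx⟩ := hge x (by omega) hx
    obtain ⟨hym, hy⟩ := hge y hly hy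
    have := (hcompat x hxm).2 y (by omega) hly (by rwa [pre_getD _ hym]) (by rwa [pre_getD _ hxm])
    rw [pre_getD _ hxm, pre_getD _ hym] at this
    simpa only [pr, Nat.unpair_pair] using this
  -- Beyond `m` the witness follows `D` rather than 0: when `m < l` the rest of the stem must be
  -- kept.
  refine ⟨fun x => if x < m then G x else D x, ⟨⟨fun x => ?_, fun x hx => ?_, fun x hx hGx => ?_⟩,
    fun x y hyx hly hy hx => (key x y hyx hly hy hx).2⟩, fun x hx => ?_, ?_⟩
  · split_ifs
    exacts [hG x, hD1 x]
  · split_ifs with hxm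
    · have := (hcompat x hxm).1 hx
      rwa [pre_getD _ hxm, pre_getD _ hx] at this
    · rfl
  · exact (key x x le_rfl hx hGx hGx).1
  · dsimp only
    rw [if_neg (by omega)]
    exact hD0 x (by omega)
  · rw [pre_map, zipWith_pre] at hPhi
    convert hPhi using 2
    refine pre_congr.2 fun x hx => ?_
    simp [pr, hx]

/-- A compatible finite extension of the stem ensures that `e` does not compute `a`. -/
def Defeats (a c : ℕ → ℕ) (T : ℕ → ℕ → Prop) (D : ℕ → ℕ) (l : ℕ) (X P : ℕ → ℕ) (e : Code) : Prop :=
  ∃ D' l', l ≤ l' ∧ Compat T D l X P D' ∧ (∀ x, l' ≤ x → D' x = 0) ∧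
    ∀ G : ℕ → ℕ, (∀ x < l', G x = D' x) → ¬ Enum (Phi e) (pr G c) a

theorem StemPhi.defeats {a c : ℕ → ℕ} {T : ℕ → ℕ → Prop} {D X P : ℕ → ℕ} {l : ℕ} {e : Code}
    {m n v : ℕ} (hD1 : ∀ x, D x ≤ 1) (hD0 : ∀ x, l ≤ x → D x = 0) (hv : v ≠ a n)
    (h : StemPhi T D l e (pre (pr P (pr X c)) m, n, v)) : Defeats a c T D l X P e := by
  obtain ⟨D', hD', h0, hPhi⟩ := h.exists_compat hD1 hD0
  refine ⟨D', max m l, le_max_right _ _, hD', h0, fun G hG hen => hv ((hen n v).1 ⟨m, ?_⟩)⟩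
  have : pre (pr G c) m = pre (pr D' c) m :=
    pre_congr.2 fun x hx => by simp [pr, hG x (lt_max_of_lt_left hx)]
  rwa [this]

/-- The forcing question for a disjunction of two requirements. -/
theorem defeats_or_exists_not_red {a c β : ℕ → ℕ} {T₀ T₁ : ℕ → ℕ → Prop} {D₀ D₁ X : ℕ → ℕ} {l : ℕ}
    (ha : ¬ Red a (pr X c)) (hβ : Primrec β) (hT₀ : PrimrecRel T₀) (hT₁ : PrimrecRel T₁)
    (h₀ : ∀ x, D₀ x ≤ 1) (h₁ : ∀ x, D₁ x ≤ 1) (hl₀ : ∀ x, l ≤ x → D₀ x = 0)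
    (hl₁ : ∀ x, l ≤ x → D₁ x = 0) (e₀ e₁ : Code) :
    (∀ P : ℕ → ℕ, (∀ x, P x ≤ β (pr X c x)) →
      Defeats a c T₀ D₀ l X P e₀ ∨ Defeats a c T₁ D₁ l X P e₁) ∨
    ∃ P : ℕ → ℕ, (∀ x, P x ≤ β (pr X c x)) ∧ ¬ Red a (pr P (pr X c)) ∧
      (∀ G, Compat T₀ D₀ l X P G → ¬ Enum (Phi e₀) (pr G c) a) ∧
      ∀ G, Compat T₁ D₁ l X P G → ¬ Enum (Phi e₁) (pr G c) a := by
  obtain ⟨n, ⟨v, hv, H⟩ | ⟨P, hP, H, hred⟩⟩ := exists_forall_wrong_or_exists_not_red ha hβ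
    ((primrecPred_StemPhi hT₀ D₀ l e₀).or (primrecPred_StemPhi hT₁ D₁ l e₁))
  · refine Or.inl fun P hP => ?_
    -- Which requirement is defeated may depend on `P`; the choice is made only once `P` is given.
    obtain ⟨m, hm | hm⟩ := H P hP
    · exact Or.inl (hm.defeats h₀ hl₀ hv)
    · exact Or.inr (hm.defeats h₁ hl₁ hv)
  · refine Or.inr ⟨P, hP, hred, fun G hG hen => ?_, fun G hG hen => ?_⟩
    · obtain ⟨m, hm⟩ := (hen n (a n)).2 rfl
      exact H m (Or.inl (hG.stemPhi hm))
    · obtain ⟨m, hm⟩ := (hen n (a n)).2 rfl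
      exact H m (Or.inr (hG.stemPhi hm))

/-! ### Strong cone avoidance for the pigeonhole principle -/

theorem Red.of_map₂ {F : ℕ → ℕ → ℕ} (hF : Primrec₂ F) {a h : ℕ → ℕ} (H : ∀ n, a n = F n (h n)) :
    Red a h := by
  have h1 : Primrec fun z : ℕ => F z.unpair.1 z.unpair.2 :=
    hF.comp (Primrec.fst.comp Primrec.unpair) (Primrec.snd.comp Primrec.unpair)
  have h2 := (Red.of_primrec (h := h) h1).comp ((Red.of_primrec (h := h) Primrec.id).pr (Red.refl h))
  simpa [CNS.pr, ← H] using h2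

theorem not_red_tail {a c X : ℕ → ℕ} (ha : ¬ Red a (pr X c)) (k : ℕ) :
    ¬ Red a (pr (fun x => if x < k then 0 else X x) c) := by
  refine fun h => ha (h.trans (Red.of_map₂
    (F := fun n z => Nat.pair (if n < k then 0 else z.unpair.1) z.unpair.2) ?_ fun n => ?_))
  · exact Primrec₂.natPair.comp (Primrec.ite (Primrec.nat_lt.comp .fst (.const k)) (.const 0)
      (Primrec.fst.comp (Primrec.unpair.comp .snd))) (Primrec.snd.comp (Primrec.unpair.comp .snd))
  · simp [pr]

theorem not_red_inter {a c g X : ℕ → ℕ} (ha : ¬ Red a (pr g (pr X c))) {p : ℕ → Prop}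
    [DecidablePred p] (hp : PrimrecPred p) :
    ¬ Red a (pr (fun x => if p (g x) then X x else 0) c) := by
  refine fun h => ha (h.trans (Red.of_map (F := fun z =>
    Nat.pair (if p z.unpair.1 then z.unpair.2.unpair.1 else 0) z.unpair.2.unpair.2) ?_ fun n => ?_))
  · have hu1 : Primrec fun z : ℕ => z.unpair.1 := Primrec.fst.comp Primrec.unpair
    have hu2 : Primrec fun z : ℕ => z.unpair.2 := Primrec.snd.comp Primrec.unpair
    exact Primrec₂.natPair.comp (Primrec.ite (hp.comp hu1) (hu1.comp hu2) (.const 0))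
      (hu2.comp hu2)
  · simp [pr]

theorem update_le_one {D : ℕ → ℕ} (h : ∀ x, D x ≤ 1) (i : ℕ) : ∀ x, Function.update D i 1 x ≤ 1 := by
  intro x
  by_cases hx : x = i
  · subst hx; simp
  · simpa [hx] using h x

theorem ext_update {D X : ℕ → ℕ} {l i : ℕ} (h : ∀ x, D x ≤ 1) (h0 : ∀ x, l ≤ x → D x = 0)
    (hi : l ≤ i) (hX : X i ≠ 0) : Ext D l X (Function.update D i 1) := by
  refine ⟨update_le_one h i, fun x hx => ?_, fun x hx hD => ?_⟩
  · rw [Function.update_of_ne (by omega)]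
  · by_cases hxi : x = i
    · rwa [hxi]
    · rw [Function.update_of_ne hxi] at hD
      exact absurd (h0 x hx) hD

/-- A pair of finite stems, inside `S` and outside `S`, with a common reservoir. -/
structure HomCond (a c X₀ : ℕ → ℕ) (S : Set ℕ) where
  D₀ : ℕ → ℕ
  D₁ : ℕ → ℕ
  l : ℕ
  X : ℕ → ℕ
  le_one₀ : ∀ x, D₀ x ≤ 1
  le_one₁ : ∀ x, D₁ x ≤ 1
  eq_zero₀ : ∀ x, l ≤ x → D₀ x = 0
  eq_zero₁ : ∀ x, l ≤ x → D₁ x = 0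
  mem₀ : ∀ x, D₀ x ≠ 0 → x ∈ S ∧ X₀ x ≠ 0
  mem₁ : ∀ x, D₁ x ≠ 0 → x ∉ S ∧ X₀ x ≠ 0
  sub : ∀ x, X x ≠ 0 → X₀ x ≠ 0
  infinite : {x | X x ≠ 0}.Infinite
  not_red : ¬ Red a (pr X c)

namespace HomCond

variable {a c X₀ : ℕ → ℕ} {S : Set ℕ}

/-- The condition `q` extends the condition `p`. -/
structure Le (q p : HomCond a c X₀ S) : Prop where
  length : p.l ≤ q.l
  ext₀ : Ext p.D₀ p.l p.X q.D₀
  ext₁ : Ext p.D₁ p.l p.X q.D₁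
  sub : ∀ x, q.X x ≠ 0 → p.X x ≠ 0

theorem Le.trans {p q r : HomCond a c X₀ S} (h : r.Le q) (h' : q.Le p) : r.Le p :=
  ⟨h'.length.trans h.length, h'.ext₀.trans h.ext₀ h'.length h'.sub,
    h'.ext₁.trans h.ext₁ h'.length h'.sub, fun x hx => h'.sub x (h.sub x hx)⟩

theorem exists_grow (p : HomCond a c X₀ S) (h₀ : ∃ x, p.l ≤ x ∧ p.X x ≠ 0 ∧ x ∈ S)
    (h₁ : ∃ x, p.l ≤ x ∧ p.X x ≠ 0 ∧ x ∉ S) :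
    ∃ q : HomCond a c X₀ S, q.Le p ∧ p.l < q.l ∧ (∃ x, p.l ≤ x ∧ q.D₀ x ≠ 0) ∧
      ∃ x, p.l ≤ x ∧ q.D₁ x ≠ 0 := by
  obtain ⟨i, hi, hiX, hiS⟩ := h₀
  obtain ⟨j, hj, hjX, hjS⟩ := h₁
  refine ⟨⟨Function.update p.D₀ i 1, Function.update p.D₁ j 1, max i j + 1, p.X,
    update_le_one p.le_one₀ i, update_le_one p.le_one₁ j, fun x hx => ?_, fun x hx => ?_,
    fun x hx => ?_, fun x hx => ?_, p.sub, p.infinite, p.not_red⟩,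
    ⟨by dsimp only; omega, ext_update p.le_one₀ p.eq_zero₀ hi hiX,
      ext_update p.le_one₁ p.eq_zero₁ hj hjX, fun _ h => h⟩, by dsimp only; omega,
    ⟨i, hi, by simp⟩, ⟨j, hj, by simp⟩⟩
  · rw [Function.update_of_ne (by omega)]
    exact p.eq_zero₀ x (by omega)
  · rw [Function.update_of_ne (by omega)]
    exact p.eq_zero₁ x (by omega)
  · by_cases hxi : x = i
    · subst hxi; exact ⟨hiS, p.sub _ hiX⟩
    · rw [Function.update_of_ne hxi] at hx
      exact p.mem₀ x hx
  · by_cases hxj : x = j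
    · subst hxj; exact ⟨hjS, p.sub _ hjX⟩
    · rw [Function.update_of_ne hxj] at hx
      exact p.mem₁ x hx

/-- Here `P` is a guess at the colouring `S`. In the positive case the guess is replaced by `S`
itself, which extends one of the stems. In the negative case the reservoir is split by `P`, and the
infinite side blocks `e₀` or `e₁` according to its colour. -/
theorem exists_force (p : HomCond a c X₀ S) (e₀ e₁ : Code) :
    ∃ q : HomCond a c X₀ S, q.Le p ∧ ∀ G₀ G₁, Ext q.D₀ q.l q.X G₀ → Ext q.D₁ q.l q.X G₁ →
      ¬ (Enum (Phi e₀) (pr G₀ c) a ∧ Enum (Phi e₁) (pr G₁ c) a) := by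
  classical
  -- `Compat.rel` includes the case `y = x`, so a relation that ignores its first argument
  -- prescribes the colour of each new element.
  have hT₀ : PrimrecRel fun _ q : ℕ => q ≠ 0 := (Primrec.eq.comp .snd (.const 0)).not
  have hT₁ : PrimrecRel fun _ q : ℕ => q = 0 := Primrec.eq.comp .snd (.const 0)
  obtain H | ⟨P, -, hred, H₀, H₁⟩ := defeats_or_exists_not_red p.not_red (Primrec.const 1) hT₀ hT₁
    p.le_one₀ p.le_one₁ p.eq_zero₀ p.eq_zero₁ e₀ e₁
  · obtain ⟨D, l, hl, hD, h0, hG⟩ | ⟨D, l, hl, hD, h0, hG⟩ := H (fun x => if x ∈ S then 1 else 0)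
      (fun x => by split_ifs <;> simp)
    · refine ⟨⟨D, p.D₁, l, p.X, hD.le_one, p.le_one₁, h0, fun x hx => p.eq_zero₁ x (hl.trans hx),
        fun x hx => ?_, p.mem₁, p.sub, p.infinite, p.not_red⟩,
        ⟨hl, hD.toExt, Ext.self p.le_one₁ p.eq_zero₁, fun _ h => h⟩,
        fun G₀ G₁ h₀ _ hen => hG G₀ h₀.agree hen.1⟩
      rcases lt_or_ge x p.l with hxl | hxl
      · exact p.mem₀ x (by rwa [← hD.agree x hxl])
      · exact ⟨by simpa using hD.rel x x le_rfl hxl hx hx, p.sub x (hD.mem x hxl hx)⟩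
    · refine ⟨⟨p.D₀, D, l, p.X, p.le_one₀, hD.le_one, fun x hx => p.eq_zero₀ x (hl.trans hx), h0,
        p.mem₀, fun x hx => ?_, p.sub, p.infinite, p.not_red⟩,
        ⟨hl, Ext.self p.le_one₀ p.eq_zero₀, hD.toExt, fun _ h => h⟩,
        fun G₀ G₁ _ h₁ hen => hG G₁ h₁.agree hen.2⟩
      rcases lt_or_ge x p.l with hxl | hxl
      · exact p.mem₁ x (by rwa [← hD.agree x hxl])
      · exact ⟨by simpa using hD.rel x x le_rfl hxl hx hx, p.sub x (hD.mem x hxl hx)⟩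
  · have hsplit : {x | p.X x ≠ 0 ∧ P x ≠ 0}.Infinite ∨ {x | p.X x ≠ 0 ∧ P x = 0}.Infinite := by
      rw [← Set.infinite_union]
      refine p.infinite.mono fun x hx => ?_
      by_cases hP : P x = 0
      exacts [Or.inr ⟨hx, hP⟩, Or.inl ⟨hx, hP⟩]
    have hp0 : PrimrecPred fun x : ℕ => x = 0 := Primrec.eq.comp .id (.const 0)
    obtain hinf | hinf := hsplit
    · have hmem : ∀ x, (if P x ≠ 0 then p.X x else 0) ≠ 0 ↔ p.X x ≠ 0 ∧ P x ≠ 0 := by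
        intro x; by_cases hP : P x = 0 <;> simp [hP]
      refine ⟨⟨p.D₀, p.D₁, p.l, fun x => if P x ≠ 0 then p.X x else 0, p.le_one₀, p.le_one₁,
        p.eq_zero₀, p.eq_zero₁, p.mem₀, p.mem₁, fun x hx => p.sub x ((hmem x).1 hx).1,
        hinf.mono fun x hx => (hmem x).2 hx, not_red_inter hred hp0.not⟩,
        ⟨le_rfl, Ext.self p.le_one₀ p.eq_zero₀, Ext.self p.le_one₁ p.eq_zero₁,
          fun x hx => ((hmem x).1 hx).1⟩, fun G₀ G₁ h₀ _ hen => H₀ G₀ ⟨?_, ?_⟩ hen.1⟩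
      · exact h₀.mono fun x hx => ((hmem x).1 hx).1
      · exact fun x y hyx hly _ hx => ((hmem x).1 (h₀.mem x (hly.trans hyx) hx)).2
    · have hmem : ∀ x, (if P x = 0 then p.X x else 0) ≠ 0 ↔ p.X x ≠ 0 ∧ P x = 0 := by
        intro x; by_cases hP : P x = 0 <;> simp [hP]
      refine ⟨⟨p.D₀, p.D₁, p.l, fun x => if P x = 0 then p.X x else 0, p.le_one₀, p.le_one₁,
        p.eq_zero₀, p.eq_zero₁, p.mem₀, p.mem₁, fun x hx => p.sub x ((hmem x).1 hx).1,
        hinf.mono fun x hx => (hmem x).2 hx, not_red_inter hred hp0⟩,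
        ⟨le_rfl, Ext.self p.le_one₀ p.eq_zero₀, Ext.self p.le_one₁ p.eq_zero₁,
          fun x hx => ((hmem x).1 hx).1⟩, fun G₀ G₁ _ h₁ hen => H₁ G₁ ⟨?_, ?_⟩ hen.2⟩
      · exact h₁.mono fun x hx => ((hmem x).1 hx).1
      · exact fun x y hyx hly _ hx => ((hmem x).1 (h₁.mem x (hly.trans hyx) hx)).2

end HomCond

/-- Elements of a generic sequence of stems: the limit is infinite and inherits what all the stems
satisfy. -/
theorem Ext.limit_infinite {D X : ℕ → ℕ → ℕ} {l : ℕ → ℕ} {G : ℕ → ℕ} (hl : StrictMono l)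
    (hG : ∀ s, Ext (D s) (l s) (X s) G) (h0 : ∀ s x, l s ≤ x → D s x = 0)
    (hgrow : ∀ s, ∃ x, l s ≤ x ∧ D (s + 1) x ≠ 0) : {x | G x ≠ 0}.Infinite := by
  refine Set.infinite_of_not_bddAbove ?_
  rintro ⟨b, hb⟩
  obtain ⟨x, hx, hD⟩ := hgrow (b + 1)
  have hxl : x < l (b + 2) := by
    by_contra hx'
    exact hD (h0 _ x (not_lt.1 hx'))
  have hGx : G x ≠ 0 := by rwa [(hG (b + 2)).agree x hxl]
  have h1 : x ≤ b := hb hGx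
  have h2 : b + 1 ≤ l (b + 1) := hl.le_apply
  omega

theorem Ext.limit_stem {D X : ℕ → ℕ → ℕ} {l : ℕ → ℕ} {G : ℕ → ℕ} (hl : StrictMono l)
    (hG : ∀ s, Ext (D s) (l s) (X s) G) {s x : ℕ} (hx : x < s) : G x = D s x :=
  (hG s).agree x (hx.trans_le hl.le_apply)

/-- Strong cone avoidance for the pigeonhole principle with two colours. -/
theorem exists_homogeneous {a c X₀ : ℕ → ℕ} (hX₀ : {x | X₀ x ≠ 0}.Infinite)
    (ha : ¬ Red a (pr X₀ c)) (S : Set ℕ) :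
    ∃ Y : ℕ → ℕ, (∀ x, Y x ≠ 0 → X₀ x ≠ 0) ∧ {x | Y x ≠ 0}.Infinite ∧ ¬ Red a (pr Y c) ∧
      ((∀ x, Y x ≠ 0 → x ∈ S) ∨ ∀ x, Y x ≠ 0 → x ∉ S) := by
  by_contra! hcon
  -- Otherwise a tail of the reservoir would itself be a homogeneous solution. Hence both stems can
  -- always grow.
  have hmeet : ∀ p : HomCond a c X₀ S, (∃ x, p.l ≤ x ∧ p.X x ≠ 0 ∧ x ∈ S) ∧
      ∃ x, p.l ≤ x ∧ p.X x ≠ 0 ∧ x ∉ S := by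
    intro p
    have hmem : ∀ x, (if x < p.l then 0 else p.X x) ≠ 0 ↔ p.l ≤ x ∧ p.X x ≠ 0 := by
      intro x
      by_cases hx : x < p.l
      · simp [hx]
      · simp [hx, not_lt.1 hx]
    obtain ⟨⟨x, hx, hxS⟩, y, hy, hyS⟩ := hcon (fun x => if x < p.l then 0 else p.X x)
      (fun x hx => p.sub x ((hmem x).1 hx).2)
      ((p.infinite.sdiff (Set.finite_Iio p.l)).mono fun x hx =>
        (hmem x).2 ⟨not_lt.1 hx.2, hx.1⟩) (not_red_tail p.not_red p.l)
    exact ⟨⟨y, ((hmem y).1 hy).1, ((hmem y).1 hy).2, hyS⟩,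
      ⟨x, ((hmem x).1 hx).1, ((hmem x).1 hx).2, hxS⟩⟩
  have hstep : ∀ (p : HomCond a c X₀ S) (e : Code × Code), ∃ q : HomCond a c X₀ S, q.Le p ∧
      p.l < q.l ∧ (∃ x, p.l ≤ x ∧ q.D₀ x ≠ 0) ∧ (∃ x, p.l ≤ x ∧ q.D₁ x ≠ 0) ∧
      ∀ G₀ G₁, Ext q.D₀ q.l q.X G₀ → Ext q.D₁ q.l q.X G₁ →
        ¬ (Enum (Phi e.1) (pr G₀ c) a ∧ Enum (Phi e.2) (pr G₁ c) a) := by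
    intro p e
    obtain ⟨q, hqp, hq⟩ := p.exists_force e.1 e.2
    obtain ⟨r, hrq, hlt, ⟨x, hx, hx0⟩, y, hy, hy0⟩ := q.exists_grow (hmeet q).1 (hmeet q).2
    exact ⟨r, hrq.trans hqp, hqp.length.trans_lt hlt, ⟨x, hqp.length.trans hx, hx0⟩,
      ⟨y, hqp.length.trans hy, hy0⟩, fun G₀ G₁ h₀ h₁ => hq G₀ G₁
        (hrq.ext₀.trans h₀ hrq.length hrq.sub) (hrq.ext₁.trans h₁ hrq.length hrq.sub)⟩
  choose next hle hlt hgrow₀ hgrow₁ hforce using hstep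
  let p₀ : HomCond a c X₀ S := ⟨fun _ => 0, fun _ => 0, 0, X₀, fun _ => Nat.zero_le _,
    fun _ => Nat.zero_le _,
    fun _ _ => rfl, fun _ _ => rfl, fun _ h => absurd rfl h, fun _ h => absurd rfl h, fun _ h => h,
    hX₀, ha⟩
  let s : ℕ → HomCond a c X₀ S :=
    fun k => Nat.rec p₀ (fun k p => next p (Denumerable.ofNat (Code × Code) k)) k
  have hl : StrictMono fun k => (s k).l := strictMono_nat_of_lt_succ fun k => hlt (s k) _
  have hsub : ∀ k x, (s (k + 1)).X x ≠ 0 → (s k).X x ≠ 0 := fun k => (hle (s k) _).sub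
  obtain ⟨G₀, hG₀⟩ := Ext.exists_limit hl (fun k => (hle (s k) _).ext₀) hsub
  obtain ⟨G₁, hG₁⟩ := Ext.exists_limit hl (fun k => (hle (s k) _).ext₁) hsub
  have hmem₀ : ∀ x, G₀ x ≠ 0 → x ∈ S ∧ X₀ x ≠ 0 := fun x hx =>
    (s (x + 1)).mem₀ x (by rwa [← Ext.limit_stem hl hG₀ (Nat.lt_succ_self x)])
  have hmem₁ : ∀ x, G₁ x ≠ 0 → x ∉ S ∧ X₀ x ≠ 0 := fun x hx =>
    (s (x + 1)).mem₁ x (by rwa [← Ext.limit_stem hl hG₁ (Nat.lt_succ_self x)])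
  -- Both limits are infinite and homogeneous, so by `hcon` each computes `a`; the two programs form
  -- a pair that was handled at some stage.
  have hred₀ : Red a (pr G₀ c) := by
    by_contra hn
    obtain ⟨⟨x, hx, hxS⟩, -⟩ := hcon G₀ (fun x hx => (hmem₀ x hx).2) (Ext.limit_infinite hl hG₀
      (fun k => (s k).eq_zero₀) (fun k => hgrow₀ (s k) _)) hn
    exact hxS (hmem₀ x hx).1
  have hred₁ : Red a (pr G₁ c) := by
    by_contra hn
    obtain ⟨-, x, hx, hxS⟩ := hcon G₁ (fun x hx => (hmem₁ x hx).2) (Ext.limit_infinite hl hG₁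
      (fun k => (s k).eq_zero₁) (fun k => hgrow₁ (s k) _)) hn
    exact (hmem₁ x hx).1 hxS
  obtain ⟨e₀, he₀⟩ := hred₀.exists_enum
  obtain ⟨e₁, he₁⟩ := hred₁.exists_enum
  have := hforce (s (encode (e₀, e₁))) (Denumerable.ofNat (Code × Code) (encode (e₀, e₁))) G₀ G₁
    (hG₀ (encode (e₀, e₁) + 1)) (hG₁ (encode (e₀, e₁) + 1))
  rw [Denumerable.ofNat_encode] at this
  exact this ⟨he₀, he₁⟩

/-! ### Non-decreasing subsequences of functions in the oracle -/

/-- The running maximum of `g` along the greedy non-decreasing subsequence in `X`. -/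
def greedyMax (g X : ℕ → ℕ) (n : ℕ) : ℕ :=
  (List.range n).foldl (fun s x => if X x ≠ 0 ∧ s ≤ g x then g x else s) 0

theorem greedyMax_succ (g X : ℕ → ℕ) (n : ℕ) :
    greedyMax g X (n + 1) =
      if X n ≠ 0 ∧ greedyMax g X n ≤ g n then g n else greedyMax g X n := by
  rw [greedyMax, List.range_succ, List.foldl_append]
  rfl

theorem greedyMax_mono (g X : ℕ → ℕ) : Monotone (greedyMax g X) := by
  refine monotone_nat_of_le_succ fun n => ?_
  rw [greedyMax_succ]
  split_ifs with h
  exacts [h.2, le_rfl]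

/-- The step of the computation of `greedyMax` from an entry of the oracle. -/
def greedyStep (s z : ℕ) : ℕ :=
  if z.unpair.2.unpair.1 ≠ 0 ∧ s ≤ z.unpair.1 then z.unpair.1 else s

/-- Membership in the greedy subsequence, as decided from an entry of the oracle. -/
def greedyTest (s z : ℕ) : ℕ :=
  if z.unpair.2.unpair.1 ≠ 0 ∧ s ≤ z.unpair.1 then 1 else 0

theorem primrec_greedyStep_greedyTest : Primrec₂ greedyStep ∧ Primrec₂ greedyTest := by
  have hu1 : Primrec fun z : ℕ => z.unpair.1 := Primrec.fst.comp Primrec.unpair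
  have hu2 : Primrec fun z : ℕ => z.unpair.2 := Primrec.snd.comp Primrec.unpair
  have hC : PrimrecPred fun q : ℕ × ℕ => q.2.unpair.2.unpair.1 ≠ 0 ∧ q.1 ≤ q.2.unpair.1 :=
    (Primrec.eq.comp (hu1.comp (hu2.comp .snd)) (.const 0)).not.and
      (Primrec.nat_le.comp .fst (hu1.comp .snd))
  exact ⟨Primrec.ite hC (hu1.comp .snd) .fst, Primrec.ite hC (.const 1) (.const 0)⟩

theorem foldl_greedyStep (g X c : ℕ → ℕ) (n : ℕ) :
    (pre (pr g (pr X c)) n).foldl greedyStep 0 = greedyMax g X n := by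
  induction n with
  | zero => rfl
  | succ n ih =>
    rw [pre_succ, List.foldl_append, ih, greedyMax_succ]
    simp [greedyStep, pr]

theorem red_greedy (g X c : ℕ → ℕ) :
    Red (pr (fun x => if X x ≠ 0 ∧ greedyMax g X x ≤ g x then 1 else 0) c) (pr g (pr X c)) := by
  have hlen : Primrec fun σ : List ℕ => σ.length - 1 :=
    Primrec.nat_sub.comp Primrec.list_length (.const 1)
  have hfold : Primrec fun σ : List ℕ => (σ.take (σ.length - 1)).foldl greedyStep 0 :=
    Primrec.list_foldl (Primrec.list_take.comp hlen .id) (.const 0)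
      (primrec_greedyStep_greedyTest.1.comp (Primrec.fst.comp .snd) (Primrec.snd.comp .snd)).to₂
  have hlast : Primrec fun σ : List ℕ => σ.getD (σ.length - 1) 0 :=
    (Primrec.list_getD 0).comp .id hlen
  have hu2 : Primrec fun z : ℕ => z.unpair.2 := Primrec.snd.comp Primrec.unpair
  have hF := Primrec₂.natPair.comp (primrec_greedyStep_greedyTest.2.comp hfold hlast)
    (hu2.comp (hu2.comp hlast))
  refine Red.of_pre hF fun n => ?_
  simp only [pre_length, Nat.add_sub_cancel]
  rw [pre_take _ (Nat.le_succ n), foldl_greedyStep, pre_getD _ (Nat.lt_succ_self n)]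
  simp [greedyTest, pr]

/-- A function in the oracle has an infinite non-decreasing subsequence inside the reservoir that
does not help to compute `a`. -/
theorem exists_nondecreasing_of_oracle {a c g X : ℕ → ℕ} (hX : {x | X x ≠ 0}.Infinite)
    (ha : ¬ Red a (pr g (pr X c))) :
    ∃ Y : ℕ → ℕ, (∀ x, Y x ≠ 0 → X x ≠ 0) ∧ {x | Y x ≠ 0}.Infinite ∧ ¬ Red a (pr Y c) ∧
      ∀ x y, Y x ≠ 0 → Y y ≠ 0 → x < y → g x ≤ g y := by
  -- The greedy subsequence may stop after an early large value unless every fibre of `g` in `X` is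
  -- finite; an infinite fibre is itself a solution.
  by_cases hk : ∃ k, {x | X x ≠ 0 ∧ g x = k}.Infinite
  · obtain ⟨k, hk⟩ := hk
    have hmem : ∀ x, (if g x = k then X x else 0) ≠ 0 ↔ X x ≠ 0 ∧ g x = k := by
      intro x; by_cases h : g x = k <;> simp [h]
    refine ⟨fun x => if g x = k then X x else 0, fun x hx => ((hmem x).1 hx).1,
      hk.mono fun x hx => (hmem x).2 hx,
      not_red_inter (p := (· = k)) ha (Primrec.eq.comp .id (.const k)), fun x y hx hy _ => ?_⟩
    rw [((hmem x).1 hx).2, ((hmem y).1 hy).2]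
  · push Not at hk
    have hmem : ∀ x, (if X x ≠ 0 ∧ greedyMax g X x ≤ g x then 1 else 0) ≠ 0 ↔
        X x ≠ 0 ∧ greedyMax g X x ≤ g x := by
      intro x; split_ifs with h <;> simp [h]
    refine ⟨fun x => if X x ≠ 0 ∧ greedyMax g X x ≤ g x then 1 else 0,
      fun x hx => ((hmem x).1 hx).1, ?_, fun h => ha (h.trans (red_greedy g X c)),
      fun x y hx hy hxy => ?_⟩
    · refine Set.infinite_of_not_bddAbove ?_
      rintro ⟨b, hb⟩
      -- If no element were taken after `b`, the maximum would be frozen and all later elements of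
      -- `X` would lie in the finitely many finite fibres below it.
      have hout : ∀ x, b < x → ¬ (X x ≠ 0 ∧ greedyMax g X x ≤ g x) := fun x hx h =>
        absurd (hb ((hmem x).2 h)) (not_le.2 hx)
      have hconst : ∀ k, greedyMax g X (b + 1 + k) = greedyMax g X (b + 1) := by
        intro k
        induction k with
        | zero => rfl
        | succ k ih => rw [← add_assoc, greedyMax_succ, if_neg (hout _ (by omega)), ih]
      refine hX (((Set.finite_Iic b).union ((Set.finite_Iio (greedyMax g X (b + 1))).biUnion
        fun k _ => hk k)).subset fun x hx => ?_)
      by_cases hxb : x ≤ b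
      · exact Or.inl hxb
      · refine Or.inr (Set.mem_biUnion (x := g x) ?_ ⟨hx, rfl⟩)
        have h1 := hconst (x - (b + 1))
        rw [show b + 1 + (x - (b + 1)) = x by omega] at h1
        rw [Set.mem_Iio, ← h1]
        by_contra hle
        exact hout x (by omega) ⟨hx, not_lt.1 hle⟩
    · have h1 : greedyMax g X (x + 1) = g x := by
        rw [greedyMax_succ, if_pos ((hmem x).1 hx)]
      exact h1 ▸ (greedyMax_mono g X hxy).trans ((hmem y).1 hy).2

/-! ### Cone avoidance for bounded functions -/

/-- If `f` is not constant on an infinite set that does not help to compute `a`, reservoirs can be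
thinned so that `f` is large on them. -/
theorem exists_thin {a c f X : ℕ → ℕ}
    (hf : ∀ (Y : ℕ → ℕ) (k : ℕ), {x | Y x ≠ 0}.Infinite → (∀ x, Y x ≠ 0 → f x = k) → Red a (pr Y c))
    (hX : {x | X x ≠ 0}.Infinite) (ha : ¬ Red a (pr X c)) (k : ℕ) :
    ∃ Y : ℕ → ℕ, (∀ x, Y x ≠ 0 → X x ≠ 0) ∧ {x | Y x ≠ 0}.Infinite ∧ ¬ Red a (pr Y c) ∧
      ∀ x, Y x ≠ 0 → k ≤ f x := by
  induction k with
  | zero => exact ⟨X, fun _ h => h, hX, ha, fun _ _ => Nat.zero_le _⟩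
  | succ k ih =>
    obtain ⟨Y, hYX, hY, hYa, hYf⟩ := ih
    -- The homogeneous set cannot lie inside the fibre, by `hf`, so it avoids the value `k`.
    obtain ⟨Z, hZY, hZ, hZa, hZf | hZf⟩ := exists_homogeneous hY hYa {x | f x = k}
    · exact absurd (hf Z k hZ hZf) hZa
    · refine ⟨Z, fun x hx => hYX x (hZY x hx), hZ, hZa, fun x hx => ?_⟩
      exact Nat.lt_of_le_of_ne (hYf x (hZY x hx)) (Ne.symm (hZf x hx))

/-- A finite stem on which `f` is non-decreasing, with a reservoir on which `f` is at least as large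
as on the stem. -/
structure MonoCond (a c f : ℕ → ℕ) where
  D : ℕ → ℕ
  l : ℕ
  X : ℕ → ℕ
  le_one : ∀ x, D x ≤ 1
  eq_zero : ∀ x, l ≤ x → D x = 0
  mono : ∀ x y, D x ≠ 0 → D y ≠ 0 → x < y → f x ≤ f y
  above : ∀ x y, D x ≠ 0 → X y ≠ 0 → f x ≤ f y
  infinite : {x | X x ≠ 0}.Infinite
  not_red : ¬ Red a (pr X c)

namespace MonoCond

variable {a c f : ℕ → ℕ}

/-- The condition `q` extends the condition `p`. -/
structure Le (q p : MonoCond a c f) : Prop where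
  length : p.l ≤ q.l
  ext : Ext p.D p.l p.X q.D
  sub : ∀ x, q.X x ≠ 0 → p.X x ≠ 0

theorem Le.trans {p q r : MonoCond a c f} (h : r.Le q) (h' : q.Le p) : r.Le p :=
  ⟨h'.length.trans h.length, h'.ext.trans h.ext h'.length h'.sub,
    fun x hx => h'.sub x (h.sub x hx)⟩

/-- Thinning the reservoir above the maximum of `f` below `l` restores `above`. Only pairs whose
smaller element is new need `hmono`; the others follow from `p.mono` and `p.above`. -/
theorem exists_of_stem (p : MonoCond a c f)
    (hf : ∀ (Y : ℕ → ℕ) (k : ℕ), {x | Y x ≠ 0}.Infinite → (∀ x, Y x ≠ 0 → f x = k) → Red a (pr Y c))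
    {D : ℕ → ℕ} {l : ℕ} (hl : p.l ≤ l) (hD : Ext p.D p.l p.X D) (h0 : ∀ x, l ≤ x → D x = 0)
    (hmono : ∀ x y, p.l ≤ x → D x ≠ 0 → D y ≠ 0 → x < y → f x ≤ f y) :
    ∃ q : MonoCond a c f, q.Le p ∧ q.D = D ∧ q.l = l := by
  obtain ⟨Y, hYX, hY, hYa, hYf⟩ := exists_thin hf p.infinite p.not_red ((Finset.range l).sup f)
  refine ⟨⟨D, l, Y, hD.le_one, h0, fun x y hx hy hxy => ?_, fun x y hx hy => ?_, hY, hYa⟩,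
    ⟨hl, hD, hYX⟩, rfl, rfl⟩
  · rcases lt_or_ge x p.l with hxl | hxl
    · have hx' : p.D x ≠ 0 := by rwa [← hD.agree x hxl]
      rcases lt_or_ge y p.l with hyl | hyl
      · exact p.mono x y hx' (by rwa [← hD.agree y hyl]) hxy
      · exact p.above x y hx' (hD.mem y hyl hy)
    · exact hmono x y hxl hx hy hxy
  · have hxl : x < l := by
      by_contra h
      exact hx (h0 x (not_lt.1 h))
    exact (Finset.le_sup (f := f) (Finset.mem_range.2 hxl)).trans (hYf y hy)

theorem exists_grow (p : MonoCond a c f)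
    (hf : ∀ (Y : ℕ → ℕ) (k : ℕ), {x | Y x ≠ 0}.Infinite → (∀ x, Y x ≠ 0 → f x = k) →
      Red a (pr Y c)) :
    ∃ q : MonoCond a c f, q.Le p ∧ p.l < q.l ∧ ∃ x, p.l ≤ x ∧ q.D x ≠ 0 := by
  obtain ⟨i, hiX, hi⟩ := p.infinite.exists_gt p.l
  have hzero : ∀ x, p.l ≤ x → x ≠ i → Function.update p.D i 1 x = 0 := fun x hx hxi => by
    rw [Function.update_of_ne hxi]
    exact p.eq_zero x hx
  have hmono : ∀ x y, p.l ≤ x → Function.update p.D i 1 x ≠ 0 → Function.update p.D i 1 y ≠ 0 →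
      x < y → f x ≤ f y := by
    intro x y hx hDx hDy hxy
    have h1 : x = i := by
      by_contra h
      exact hDx (hzero x hx h)
    exact absurd (hzero y (by omega) (by omega)) hDy
  obtain ⟨q, hq, hqD, hql⟩ := p.exists_of_stem hf (l := i + 1) (by omega)
    (ext_update p.le_one p.eq_zero hi.le hiX) (fun x hx => hzero x (by omega) (by omega)) hmono
  exact ⟨q, hq, by omega, i, hi.le, by simp [hqD]⟩

theorem exists_force (p : MonoCond a c f) {β : ℕ → ℕ} (hβ : Primrec β) (hfβ : ∀ x, f x ≤ β (c x))
    (hf : ∀ (Y : ℕ → ℕ) (k : ℕ), {x | Y x ≠ 0}.Infinite → (∀ x, Y x ≠ 0 → f x = k) → Red a (pr Y c))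
    (e : Code) :
    ∃ q : MonoCond a c f, q.Le p ∧ ∀ G, Ext q.D q.l q.X G → ¬ Enum (Phi e) (pr G c) a := by
  have hβ' : Primrec fun z : ℕ => β z.unpair.2 := hβ.comp (Primrec.snd.comp Primrec.unpair)
  -- There is one requirement here, so it is used as both disjuncts. The true `f` is one of the
  -- bounded `P`, although it is not in the oracle.
  obtain H | ⟨P, -, hred, H, -⟩ := defeats_or_exists_not_red p.not_red hβ' Primrec.nat_le
    Primrec.nat_le p.le_one p.le_one p.eq_zero p.eq_zero e e
  · obtain ⟨D, l, hl, hD, h0, hG⟩ := or_self_iff.1 (H f fun x => by simpa [pr] using hfβ x)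
    obtain ⟨q, hq, rfl, rfl⟩ := p.exists_of_stem hf hl hD.toExt h0
      (fun x y hx hDx hDy hxy => hD.rel y x hxy.le hx hDx hDy)
    exact ⟨q, hq, fun G h => hG G h.agree⟩
  · obtain ⟨Y, hYX, hY, hYa, hmono⟩ := exists_nondecreasing_of_oracle p.infinite hred
    refine ⟨⟨p.D, p.l, Y, p.le_one, p.eq_zero, p.mono, fun x y hx hy => p.above x y hx (hYX y hy),
      hY, hYa⟩, ⟨le_rfl, Ext.self p.le_one p.eq_zero, hYX⟩, fun G h => H G ⟨h.mono hYX, ?_⟩⟩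
    intro x y hyx hly hy hx
    rcases hyx.eq_or_lt with rfl | hlt
    · exact le_rfl
    · exact hmono y x (h.mem y hly hy) (h.mem x (hly.trans hyx) hx) hlt

end MonoCond

/-- Strong cone avoidance for non-decreasing subsequences of a function that is bounded by a
function in the oracle. -/
theorem exists_nondecreasing_of_bounded {a c f β : ℕ → ℕ} (ha : ¬ Red a c) (hβ : Primrec β)
    (hfβ : ∀ x, f x ≤ β (c x)) :
    ∃ G : ℕ → ℕ, {x | G x ≠ 0}.Infinite ∧ (∀ x y, G x ≠ 0 → G y ≠ 0 → x < y → f x ≤ f y) ∧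
      ¬ Red a (pr G c) := by
  by_contra! hcon
  -- A set on which `f` is constant is non-decreasing, so the assumption that there is no solution
  -- supplies the thinning hypothesis.
  have hf : ∀ (Y : ℕ → ℕ) (k : ℕ), {x | Y x ≠ 0}.Infinite → (∀ x, Y x ≠ 0 → f x = k) →
      Red a (pr Y c) := fun Y k hY hk => hcon Y hY fun x y hx hy _ => by rw [hk x hx, hk y hy]
  have hstep : ∀ (p : MonoCond a c f) (e : Code), ∃ q : MonoCond a c f, q.Le p ∧ p.l < q.l ∧
      (∃ x, p.l ≤ x ∧ q.D x ≠ 0) ∧ ∀ G, Ext q.D q.l q.X G → ¬ Enum (Phi e) (pr G c) a := by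
    intro p e
    obtain ⟨q, hqp, hq⟩ := p.exists_force hβ hfβ hf e
    obtain ⟨r, hrq, hlt, x, hx, hx0⟩ := q.exists_grow hf
    exact ⟨r, hrq.trans hqp, hqp.length.trans_lt hlt, ⟨x, hqp.length.trans hx, hx0⟩,
      fun G h => hq G (hrq.ext.trans h hrq.length hrq.sub)⟩
  choose next hle hlt hgrow hforce using hstep
  let p₀ : MonoCond a c f := ⟨fun _ => 0, 0, fun _ => 1, fun _ => Nat.zero_le _, fun _ _ => rfl,
    fun _ _ h => absurd rfl h, fun _ _ h => absurd rfl h, by simpa using Set.infinite_univ,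
    fun h => ha (h.trans (Red.of_map (Primrec₂.natPair.comp (.const 1) .id) fun _ => rfl))⟩
  let s : ℕ → MonoCond a c f := fun k => Nat.rec p₀ (fun k p => next p (Denumerable.ofNat Code k)) k
  have hl : StrictMono fun k => (s k).l := strictMono_nat_of_lt_succ fun k => hlt (s k) _
  obtain ⟨G, hG⟩ := Ext.exists_limit hl (fun k => (hle (s k) _).ext) (fun k => (hle (s k) _).sub)
  have hred := hcon G (Ext.limit_infinite hl hG (fun k => (s k).eq_zero) (fun k => hgrow (s k) _))
    fun x y hx hy hxy => (s (y + 1)).mono x y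
      (by rwa [← Ext.limit_stem hl hG (hxy.trans (Nat.lt_succ_self y))])
      (by rwa [← Ext.limit_stem hl hG (Nat.lt_succ_self y)]) hxy
  obtain ⟨e, he⟩ := hred.exists_enum
  have := hforce (s (encode e)) (Denumerable.ofNat Code (encode e)) G (hG (encode e + 1))
  rw [Denumerable.ofNat_encode] at this
  exact this he

/-! ### Sets as oracles -/

open Classical in
/-- The characteristic function of a set as a total function. -/
noncomputable def chi (S : Set ℕ) : ℕ → ℕ := fun n => if n ∈ S then 1 else 0

theorem setTuringReducible_iff {A B : Set ℕ} : SetTuringReducible A B ↔ Red (chi A) (chi B) :=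
  RecursiveIn.iff_nat

theorem chi_join (G C : Set ℕ) (n : ℕ) :
    chi (join G C) n = if n % 2 = 0 then chi G (n / 2) else chi C (n / 2) := by
  have hmem : n ∈ join G C ↔ if n % 2 = 0 then n / 2 ∈ G else n / 2 ∈ C := by
    simp only [join, Set.mem_union, Set.mem_image]
    split_ifs with h
    · constructor
      · rintro (⟨x, hx, rfl⟩ | ⟨x, hx, rfl⟩)
        · simpa using hx
        · omega
      · exact fun hn => Or.inl ⟨n / 2, hn, by omega⟩
    · constructor
      · rintro (⟨x, hx, rfl⟩ | ⟨x, hx, rfl⟩)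
        · omega
        · rwa [show (2 * x + 1) / 2 = x by omega]
      · exact fun hn => Or.inr ⟨n / 2, hn, by omega⟩
  unfold chi
  split_ifs at hmem ⊢ <;> simp_all

theorem red_chi_join (G C : Set ℕ) : Red (chi (join G C)) (pr (chi G) (chi C)) := by
  have h2 : Red (fun n => pr (chi G) (chi C) (n / 2)) (pr (chi G) (chi C)) :=
    (Red.refl _).comp (.of_primrec (Primrec.nat_div.comp .id (.const 2)))
  have hF : Primrec fun z : ℕ => if z.unpair.1 % 2 = 0 then z.unpair.2.unpair.1
      else z.unpair.2.unpair.2 := by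
    have hu1 : Primrec fun z : ℕ => z.unpair.1 := Primrec.fst.comp Primrec.unpair
    have hu2 : Primrec fun z : ℕ => z.unpair.2 := Primrec.snd.comp Primrec.unpair
    exact Primrec.ite (Primrec.eq.comp (Primrec.nat_mod.comp hu1 (.const 2)) (.const 0))
      (hu1.comp hu2) (hu2.comp hu2)
  have h := (Red.of_primrec (h := pr (chi G) (chi C)) hF).comp ((Red.of_primrec Primrec.id).pr h2)
  have heq : chi (join G C) = fun n => (fun z : ℕ => if z.unpair.1 % 2 = 0 then z.unpair.2.unpair.1
      else z.unpair.2.unpair.2) (pr id (fun n => pr (chi G) (chi C) (n / 2)) n) := by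
    funext n
    simp [chi_join, pr]
  rw [heq]
  exact h

end CNS

theorem mainTheorem10 (C A : Set ℕ) (hA : ¬ CNS.SetTuringReducible A C)
    (f : ℕ → ℕ) (hf : CNS.ComputablyBoundedIn C f) :
    ∃ G : Set ℕ, G.Infinite ∧ CNS.NonDecreasingFor f G ∧
      ¬ CNS.SetTuringReducible A (CNS.join G C) := by
  obtain ⟨b, hb, hfb⟩ := hf
  have hb : CNS.Red b (CNS.chi C) := RecursiveIn.iff_nat.1 hb
  rw [CNS.setTuringReducible_iff] at hA
  have hu1 : Primrec fun z : ℕ => z.unpair.1 := Primrec.fst.comp Primrec.unpair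
  have hu2 : Primrec fun z : ℕ => z.unpair.2 := Primrec.snd.comp Primrec.unpair
  -- The bound `b` is put into the oracle next to `C`, which makes it a primitive recursive
  -- projection of `c`; being `C`-computable, it adds no power.
  obtain ⟨G, hG, hmono, hred⟩ := CNS.exists_nondecreasing_of_bounded (f := f)
    (c := CNS.pr (CNS.chi C) b) (fun h => hA (h.trans ((CNS.Red.refl _).pr hb))) hu2
    (fun x => by simpa [CNS.pr] using hfb x)
  refine ⟨{x | G x ≠ 0}, hG, fun x hx y hy hxy => hmono x y hx hy hxy, fun h => hred ?_⟩
  rw [CNS.setTuringReducible_iff] at h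
  refine (h.trans (CNS.red_chi_join _ _)).trans (CNS.Red.of_map (F := fun z =>
    Nat.pair (if z.unpair.1 ≠ 0 then 1 else 0) z.unpair.2.unpair.1) ?_ fun n => ?_)
  · exact Primrec₂.natPair.comp (Primrec.ite (Primrec.eq.comp hu1 (.const 0)).not (.const 1)
      (.const 0)) (hu1.comp hu2)
  · simp [CNS.pr, CNS.chi]
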